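/- Let $n\ge 1$; write points of $\mathbb R^n$ as $(x,y)$ with $x\in\mathbb R^{n-1}$, $y\in\mathbb R$. *Front-like functions.* A function $g\in L^\infty_{\rm loc}(\mathbb R^n)$ is front-like if there are locally Lipschitz functions $\underline G,\overline G:\mathbb R\to\mathbb R$ that are $C^1$ with positive derivative on $\mathbb R\setminus\{0\}$, such that $\underline G(0)=\overline G(0)=0$ and $\underline G(y)\le g(x,y)\le\overline G(y)$ for all $(x,y)$. *Advection.* Let $(\Omega,\mathcal F,P)$ be a probability space and let $w:\mathbb R\times\Omega\to\mathbb R$ be a mild approximation of white noise: (i) there is $M>0$ with $\|w\|_{C^1(\mathbb R)}\le M$ almost surely; (ii) $E[w(y)]=0$ for all $y$; (iii) $w$ is stationary and, for some $p>3/2$, $\int_0^\infty\rho(y)^{1/p}\,dy<\infty$, where $\rho(y)$ is the supremum of $|P(A\cap B)-P(A)P(B)|/P(B)$ over all $y_1\le y_2$, $A\in\sigma(w(s):s\ge y_2+y)$ and $B\in\sigma(w(s):y_1\le s\le y_2)$ with $P(B)>0$. Let $u(x,y,t)=(u_\perp(x,y,t),\,u_\parallel(x,t)w(y))$, where $u_\perp$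 and $u_\parallel$ are $C^2$ for $t\ge 0$, with values in $\mathbb R^{n-1}$ and $\mathbb R$, and $\|u\|_{C^1(\mathbb R^n\times[0,\infty))}<\infty$ almost surely. *Equations.* For $\epsilon>0$ and $\alpha\in[1,\infty]$ (with $\epsilon^\infty:=0$) consider, in $\mathbb R^n\times(0,\infty)$, the G-equation $$G_t+\epsilon u(x,y,\epsilon^\alpha t)\cdot\nabla G+|\nabla G|=0$$ and the eikonal equation (with $\beta=\infty$, that is, without viscosity) $$v_t+\epsilon u(x,y,\epsilon^\alpha t)\cdot\nabla v+\tfrac12|\nabla v|^2+\tfrac12=0 .$$ A solution with initial datum $v_0$ is a function on $\mathbb R^n\times[0,\infty)$ that is continuous for $t>0$, is a viscosity solution for $t>0$, equals $v_0$ at $t=0$, and attains $v_0$ in the sense that, at $t=0$, its upper and lower semicontinuous envelopes on $\mathbb R^n\times[0,\infty)$ satisfy $v^*\le (v_0)^*$ and $v_*\ge (v_0)_*$. A perturbed traveling wave for one of the equations is a solution of it of the form $y-t+\epsilon^{2/3}\chi(x,\epsilon^{2/3}y,\epsilon^{2/3}t)$ whose initial datum is front-like and globally Lipschitz. **Proposition.**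 Almost surely, the following holds for all $\epsilon>0$ and $\alpha\in[1,\infty]$. Let $G^\epsilon_{\rm ptw}$ and $v^\epsilon_{\rm ptw}$ be perturbed traveling waves for the G-equation and for the eikonal equation, respectively. Let $v_0$ be front-like with $v_0\ge v^\epsilon_{\rm ptw}(\cdot,\cdot,0)$ in $\mathbb R^n$, and let $v^\epsilon$ be a solution of the eikonal equation with initial datum $v_0$. Then, for every $t\ge0$, $$\{(x,y):G^\epsilon_{\rm ptw}(x,y,t)\le0\}\subset\{(x,y):v^\epsilon(x,y,t)\le0\}\subset\{(x,y):v^\epsilon_{\rm ptw}(x,y,t)\le0\}.$$ -/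

import Mathlib

open MeasureTheory ProbabilityTheory Filter Topology Set
open scoped ENNReal

noncomputable section

namespace FrontProp

/-- The space `ℝⁿ` with `n = m + 1`; its points are written `(x, y)`, where `x ∈ ℝᵐ` consists of the
first `m` coordinates and `y ∈ ℝ` is the last one. -/
abbrev Space (m : ℕ) : Type := EuclideanSpace ℝ (Fin (m + 1))

/-- The transverse variable `x ∈ ℝᵐ` of a point `(x, y)`. -/
def xPart {m : ℕ} (z : Space m) : EuclideanSpace ℝ (Fin m) :=
  WithLp.toLp 2 fun i => z i.castSucc

/-- The variable `y ∈ ℝ` of a point `(x, y)`. -/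
def yPart {m : ℕ} (z : Space m) : ℝ := z (Fin.last m)

/-! ### Front-like initial data -/

/-- A function of class `C^{0,1}_loc(ℝ) ∩ C¹_loc(ℝ₋ ∪ ℝ₊)` that has positive derivative on
`ℝ₋ ∪ ℝ₊` and vanishes at the origin. -/
structure IsProfile (g : ℝ → ℝ) : Prop where
  locallyLipschitz : LocallyLipschitz g
  contDiffOn : ContDiffOn ℝ 1 g {0}ᶜ
  deriv_pos : ∀ y, y ≠ 0 → 0 < deriv g y
  map_zero : g 0 = 0

/-- Front-like functions on `ℝⁿ`: locally (essentially) bounded, and trapped between two profiles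
that depend on `y` alone. -/
structure FrontLike {m : ℕ} (g : Space m → ℝ) : Prop where
  locallyBounded : ∀ K : Set (Space m), IsCompact K → MemLp g ⊤ (volume.restrict K)
  exists_profiles : ∃ lo hi : ℝ → ℝ, IsProfile lo ∧ IsProfile hi ∧
    ∀ z, lo (yPart z) ≤ g z ∧ g z ≤ hi (yPart z)

/-! ### Mild white noise and the advection -/

section Noise

variable {Ω : Type*} [MeasurableSpace Ω]

/-- The σ-algebra generated by the variables `w y`, `y ∈ I`. -/
abbrev sigmaOn (w : ℝ → Ω → ℝ) (I : Set ℝ) : MeasurableSpace Ω :=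
  ⨆ y ∈ I, MeasurableSpace.comap (w y) inferInstance

/-- The mixing coefficient: the supremum of `|P(A ∩ B) - P(A) P(B)| / P(B)` over `y₁ ≤ y₂`,
`A ∈ σ(w(s) : s ≥ y₂ + y)` and `B ∈ σ(w(s) : y₁ ≤ s ≤ y₂)`.
Sets `B` of probability zero contribute `0 / 0 = 0`. -/
def mixingCoeff (P : Measure Ω) (w : ℝ → Ω → ℝ) (y : ℝ) : ℝ≥0∞ :=
  ⨆ (y₁ : ℝ) (y₂ : ℝ) (_ : y₁ ≤ y₂) (A : Set Ω) (B : Set Ω)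
    (_ : MeasurableSet[sigmaOn w (Ici (y₂ + y))] A)
    (_ : MeasurableSet[sigmaOn w (Icc y₁ y₂)] B),
    ENNReal.ofReal |P.real (A ∩ B) - P.real A * P.real B| / P B

/-- Mild approximation of white noise: a process that is almost surely bounded in `C¹(ℝ)` by a
deterministic constant, centred, stationary, and strongly mixing with rate `p > 3/2`. -/
structure IsMildWhiteNoise (P : Measure Ω) (w : ℝ → Ω → ℝ) : Prop where
  measurable : ∀ y, Measurable (w y)
  bounded : ∃ M : ℝ, 0 < M ∧ ∀ᵐ ω ∂P, ContDiff ℝ 1 (fun y => w y ω) ∧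
    ∀ y, |w y ω| ≤ M ∧ |deriv (fun y' => w y' ω) y| ≤ M
  centered : ∀ y, ∫ ω, w y ω ∂P = 0
  stationary : ∀ h : ℝ,
    IdentDistrib (fun ω (y : ℝ) => w (y + h) ω) (fun ω (y : ℝ) => w y ω) P P
  mixing : ∃ p : ℝ, 3 / 2 < p ∧ ∫⁻ y in Ioi (0 : ℝ), mixingCoeff P w y ^ (1 / p) < ⊤

end Noise

/-- The closed half-space `ℝⁿ × [0, ∞)` (or `ℝᵐ × [0, ∞)`) of space-time. -/
def closedHalf (X : Type*) : Set (X × ℝ) := univ ×ˢ Ici 0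

/-- The advection `u(x, y, t) = (u_⊥(x, y, t), u_∥(x, t) w(y))`, for one realization of `w`. -/
def advection {m : ℕ} (uperp : Space m → ℝ → EuclideanSpace ℝ (Fin m))
    (upar : EuclideanSpace ℝ (Fin m) → ℝ → ℝ) (w : ℝ → ℝ) (z : Space m) (t : ℝ) : Space m :=
  WithLp.toLp 2
    (Fin.snoc (α := fun _ => ℝ) (fun i => uperp z t i) (upar (xPart z) t * w (yPart z)))

/-- The `C¹` norm of `u` on `ℝⁿ × [0, ∞)` is finite. -/
def HasFiniteC1Norm {m : ℕ} (u : Space m → ℝ → Space m) : Prop :=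
  ∃ C : ℝ, ∀ z t, 0 ≤ t → ‖u z t‖ ≤ C ∧
    ‖fderivWithin ℝ (Function.uncurry u) (closedHalf (Space m)) (z, t)‖ ≤ C

/-- The assumption on the advection: `w` is mild white noise, `u_⊥` and `u_∥` are of class `C²` up to
time `0`, and `u` has finite `C¹` norm almost surely. -/
structure IsAdmissible {Ω : Type*} [MeasurableSpace Ω] (P : Measure Ω) {m : ℕ} (w : ℝ → Ω → ℝ)
    (uperp : Space m → ℝ → EuclideanSpace ℝ (Fin m))
    (upar : EuclideanSpace ℝ (Fin m) → ℝ → ℝ) : Prop where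
  noise : IsMildWhiteNoise P w
  perp : ContDiffOn ℝ 2 (Function.uncurry uperp) (closedHalf (Space m))
  par : ContDiffOn ℝ 2 (Function.uncurry upar) (closedHalf (EuclideanSpace ℝ (Fin m)))
  finiteC1 : ∀ᵐ ω ∂P, HasFiniteC1Norm (advection uperp upar fun y => w y ω)

/-! ### Viscosity solutions of `v_t + H(z, t, ∇v) = 0` -/

section Viscosity

variable {m : ℕ}

/-- Viscosity sub-solutions in `ℝⁿ × (0, ∞)`. -/
def IsSubsolution (H : Space m → ℝ → Space m → ℝ) (v : Space m → ℝ → ℝ) : Prop :=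
  ∀ ψ : Space m × ℝ → ℝ, ContDiff ℝ 1 ψ → ∀ z t, 0 < t →
    IsLocalMax (fun q : Space m × ℝ => v q.1 q.2 - ψ q) (z, t) →
      deriv (fun s => ψ (z, s)) t + H z t (gradient (fun z' => ψ (z', t)) z) ≤ 0

/-- Viscosity super-solutions in `ℝⁿ × (0, ∞)`. -/
def IsSupersolution (H : Space m → ℝ → Space m → ℝ) (v : Space m → ℝ → ℝ) : Prop :=
  ∀ ψ : Space m × ℝ → ℝ, ContDiff ℝ 1 ψ → ∀ z t, 0 < t →
    IsLocalMin (fun q : Space m × ℝ => v q.1 q.2 - ψ q) (z, t) →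
      0 ≤ deriv (fun s => ψ (z, s)) t + H z t (gradient (fun z' => ψ (z', t)) z)

/-- Viscosity solutions of the initial value problem `v_t + H(z, t, ∇v) = 0` in `ℝⁿ × (0, ∞)`,
`v(·, 0) = v₀`. The function is continuous at positive times. As `v₀` may be discontinuous, it is
attained in the sense of semicontinuous envelopes: `(v₀)_* ≤ v_*` and `v^* ≤ (v₀)^*` at `t = 0`
(at a point of continuity of `v₀` this says that `v` is continuous there). -/
structure IsSolution (H : Space m → ℝ → Space m → ℝ) (v₀ : Space m → ℝ)
    (v : Space m → ℝ → ℝ) : Prop where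
  continuousOn : ContinuousOn (Function.uncurry v) (univ ×ˢ Ioi 0)
  sub : IsSubsolution H v
  super : IsSupersolution H v
  initial : ∀ z, v z 0 = v₀ z
  initial_upper : ∀ z,
    limsup (fun q : Space m × ℝ => (v q.1 q.2 : EReal)) (𝓝[closedHalf (Space m)] (z, 0)) ≤
      limsup (fun z' => (v₀ z' : EReal)) (𝓝 z)
  initial_lower : ∀ z,
    liminf (fun z' => (v₀ z' : EReal)) (𝓝 z) ≤
      liminf (fun q : Space m × ℝ => (v q.1 q.2 : EReal)) (𝓝[closedHalf (Space m)] (z, 0))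

/-- `ε ^ α` for `α ∈ [0, ∞]`, with the convention `ε ^ ∞ = 0`. -/
def epsPow (ε : ℝ) (α : ℝ≥0∞) : ℝ := if α = ⊤ then 0 else ε ^ α.toReal

/-- The Hamiltonian `ε u(x, y, ε^α t) · p + |p|` of the G-equation. -/
def geometricH (u : Space m → ℝ → Space m) (ε : ℝ) (α : ℝ≥0∞)
    (z : Space m) (t : ℝ) (p : Space m) : ℝ :=
  ε * inner ℝ (u z (epsPow ε α * t)) p + ‖p‖

/-- The Hamiltonian `ε u(x, y, ε^α t) · p + |p|² / 2 + 1 / 2` of the eikonal equation without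
viscosity (`β = ∞`). -/
def eikonalH (u : Space m → ℝ → Space m) (ε : ℝ) (α : ℝ≥0∞)
    (z : Space m) (t : ℝ) (p : Space m) : ℝ :=
  ε * inner ℝ (u z (epsPow ε α * t)) p + ‖p‖ ^ 2 / 2 + 1 / 2

/-- The function `y - t + ε^{2/3} χ(x, ε^{2/3} y, ε^{2/3} t)`. -/
def ptw (ε : ℝ) (χ : EuclideanSpace ℝ (Fin m) → ℝ → ℝ → ℝ) (z : Space m) (t : ℝ) : ℝ :=
  yPart z - t +
    ε ^ (2 / 3 : ℝ) * χ (xPart z) (ε ^ (2 / 3 : ℝ) * yPart z) (ε ^ (2 / 3 : ℝ) * t)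

/-- `y - t + ε^{2/3} χ(x, ε^{2/3} y, ε^{2/3} t)` is a perturbed traveling wave for the Hamiltonian
`H`: it solves the equation, and its initial datum is front-like and globally Lipschitz.
(Local boundedness of `χ` is a consequence.) -/
structure IsPTW (H : Space m → ℝ → Space m → ℝ) (ε : ℝ)
    (χ : EuclideanSpace ℝ (Fin m) → ℝ → ℝ → ℝ) : Prop where
  solution : IsSolution H (fun z => ptw ε χ z 0) (ptw ε χ)
  frontLike : FrontLike fun z => ptw ε χ z 0
  lipschitz : ∃ K, LipschitzWith K fun z => ptw ε χ z 0

end Viscosity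

end FrontProp

end

/-!
Since `|p| ≤ |p|² / 2 + 1 / 2`, a sub-solution of the eikonal equation is a sub-solution of the
G-equation. The G-equation has finite speed of propagation and is invariant under increasing
relabelling of level sets, so only the inclusion of the initial sublevel sets `{· ≤ 0}` matters
there: replacing `G` by `η * exp (k * G + 1)` turns it into an inequality between initial data, up
to an error proportional to `η`. This gives the first inclusion.

The second inclusion is comparison for the eikonal equation, where the quadratic Hamiltonian gives
no finite speed of propagation. Comparison in thin tubes around straight lines bounds a solution
above and below by its values at other times (a weak Hopf-Lax formula), which yields at most
quadratic decay with an arbitrarily small constant; by convexity a sub-solution can be mixed with an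
explicit classical one that decreases quadratically, and this confines the comparison to a compact
set.
-/

namespace FrontProp

theorem exists_le_mul_exp {X : Type*} [TopologicalSpace X] {K : Set X} {g h : X → ℝ} {η : ℝ}
    (hK : IsCompact K) (hg : ContinuousOn g K) (hh : ContinuousOn h K)
    (hgh : ∀ x ∈ K, g x ≤ 0 → h x ≤ 0) (hη : 0 < η) :
    ∃ k, 0 < k ∧ ∀ x ∈ K, h x ≤ η * Real.exp (k * g x) := by
  have hpos : ∀ x ∈ K, 0 < max (g x) (η - h x) := fun x hx => by
    rcases le_or_gt (g x) 0 with h0 | h0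
    · exact lt_max_of_lt_right (by linarith [hgh x hx h0])
    · exact lt_max_of_lt_left h0
  obtain ⟨μ, hμ, hμK⟩ : ∃ μ, 0 < μ ∧ ∀ x ∈ K, μ ≤ max (g x) (η - h x) :=
    hK.exists_forall_le' (hg.sup (continuousOn_const.sub hh)) hpos
  obtain ⟨A, hA⟩ := hK.bddAbove_image hh
  have hk : 0 < (|A| + 1) / (η * μ) := by positivity
  refine ⟨_, hk, fun x hx => ?_⟩
  rcases le_or_gt (h x) η with hle | hgt
  · rcases le_or_gt (g x) 0 with h0 | h0
    · exact (hgh x hx h0).trans (by positivity)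
    · exact hle.trans (le_mul_of_one_le_right hη.le (Real.one_le_exp (by positivity)))
  have hμg : μ ≤ g x := (le_max_iff.1 (hμK x hx)).resolve_right (by linarith)
  calc h x ≤ |A| := (hA (mem_image_of_mem h hx)).trans (le_abs_self A)
    _ ≤ η * ((|A| + 1) / (η * μ) * μ) := by field_simp; linarith
    _ ≤ η * Real.exp ((|A| + 1) / (η * μ) * g x) := by
      gcongr
      exact (mul_le_mul_of_nonneg_left hμg hk.le).trans
        ((le_add_of_nonneg_right zero_le_one).trans (Real.add_one_le_exp _))

theorem exists_contDiff_eventuallyEq {E : Type*} [NormedAddCommGroup E] [NormedSpace ℝ E]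
    [HasContDiffBump E] {f : E → ℝ} {x : E} (hf : ContDiffAt ℝ 1 f x) :
    ∃ g : E → ℝ, ContDiff ℝ 1 g ∧ g =ᶠ[𝓝 x] f := by
  obtain ⟨r, hr, hfr⟩ := Metric.eventually_nhds_iff_ball.1 (hf.eventually (by simp))
  let c : ContDiffBump x := ⟨r / 3, r / 2, by positivity, by linarith⟩
  refine ⟨fun y => c y * f y, contDiff_iff_contDiffAt.2 fun y => ?_, ?_⟩
  · by_cases hy : y ∈ tsupport c
    · rw [c.tsupport_eq] at hy
      exact c.contDiffAt.mul (hfr y (Metric.closedBall_subset_ball (half_lt_self hr) hy))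
    · refine (contDiffAt_const (c := (0 : ℝ))).congr_of_eventuallyEq ?_
      filter_upwards [notMem_tsupport_iff_eventuallyEq.1 hy] with z hz
      rw [hz, Pi.zero_apply, zero_mul]
  · filter_upwards [c.eventuallyEq_one] with y hy
    rw [hy, Pi.one_apply, one_mul]

theorem exists_contDiff_rightInverse {f : ℝ → ℝ} {a : ℝ} (hf : ContDiffAt ℝ 1 f a)
    (hfa : deriv f a ≠ 0) :
    ∃ g : ℝ → ℝ, ContDiff ℝ 1 g ∧ HasDerivAt g (deriv f a)⁻¹ (f a) ∧
      ∀ᶠ y in 𝓝 (f a), f (g y) = y := by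
  have hstrict : HasStrictDerivAt f (deriv f a) a := hf.hasStrictDerivAt one_ne_zero
  have hlocal : ContDiffAt ℝ 1 (hstrict.localInverse f _ a hfa) (f a) :=
    hf.to_localInverse (hstrict.hasStrictFDerivAt_equiv hfa).hasFDerivAt one_ne_zero
  obtain ⟨g, hg, hgf⟩ := exists_contDiff_eventuallyEq hlocal
  refine ⟨g, hg, (hstrict.to_localInverse hfa).hasDerivAt.congr_of_eventuallyEq hgf, ?_⟩
  filter_upwards [hgf, hstrict.eventually_right_inverse hfa] with y hy hfy
  rw [hy, hfy]

theorem exists_tendsto_isMaxOn_doubled {X : Type*} [TopologicalSpace X] [FirstCountableTopology X]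
    {K : Set X} {U V : X → ℝ} {D : X × X → ℝ} (hK : IsCompact K) (hne : K.Nonempty)
    (hU : ContinuousOn U K) (hV : ContinuousOn V K) (hD : Continuous D) (hD0 : ∀ r, 0 ≤ D r)
    (hDeq : ∀ r, D r = 0 ↔ r.1 = r.2) :
    ∃ a ∈ K, IsMaxOn (fun x => U x - V x) K a ∧ ∃ (N : ℕ → ℝ) (r : ℕ → X × X),
      (∀ n, 0 ≤ N n ∧ IsMaxOn (fun r => U r.1 - V r.2 - N n * D r) (K ×ˢ K) (r n)) ∧
      Tendsto r atTop (𝓝 (a, a)) ∧ Tendsto (fun n => N n * D (r n)) atTop (𝓝 0) := by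
  obtain ⟨x₀, hx₀, hmax⟩ := hK.exists_isMaxOn hne (hU.sub hV)
  have hW : ContinuousOn (fun r : X × X => U r.1 - V r.2) (K ×ˢ K) :=
    (hU.comp continuousOn_fst fun r hr => hr.1).sub (hV.comp continuousOn_snd fun r hr => hr.2)
  choose r hrK hrmax using fun n : ℕ => (hK.prod hK).exists_isMaxOn ⟨(x₀, x₀), hx₀, hx₀⟩
    (hW.sub (hD.continuousOn.const_mul (n : ℝ)))
  have hle : ∀ n : ℕ, n * D (r n) ≤ U (r n).1 - V (r n).2 - (U x₀ - V x₀) := fun n => by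
    have h : U x₀ - V x₀ - n * D (x₀, x₀) ≤ U (r n).1 - V (r n).2 - n * D (r n) :=
      hrmax n (mk_mem_prod hx₀ hx₀)
    rw [(hDeq (x₀, x₀)).2 rfl] at h
    linarith
  obtain ⟨⟨a, a'⟩, haK, φ, hφ, hlim⟩ := (hK.prod hK).tendsto_subseq hrK
  have hgap : Tendsto (fun n => U (r (φ n)).1 - V (r (φ n)).2 - (U x₀ - V x₀)) atTop
      (𝓝 (U a - V a' - (U x₀ - V x₀))) :=
    ((hW _ haK).tendsto.comp (tendsto_nhdsWithin_iff.2
      ⟨hlim, Eventually.of_forall fun n => hrK _⟩)).sub_const _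
  have hDlim : Tendsto (fun n => D (r (φ n))) atTop (𝓝 (D (a, a'))) := (hD.tendsto _).comp hlim
  have hN : Tendsto (fun n => (φ n : ℝ)) atTop atTop :=
    tendsto_natCast_atTop_atTop.comp hφ.tendsto_atTop
  obtain rfl : a = a' := (hDeq (a, a')).1 <| (hD0 _).antisymm' <| not_lt.1 fun hpos =>
    not_tendsto_nhds_of_tendsto_atTop
      (tendsto_atTop_mono (fun n => hle (φ n)) (hN.atTop_mul_pos hpos hDlim)) _ hgap
  have hnonneg : ∀ n, 0 ≤ (φ n : ℝ) * D (r (φ n)) := fun n => mul_nonneg (Nat.cast_nonneg _) (hD0 _)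
  have ha : U a - V a = U x₀ - V x₀ := (hmax haK.1).antisymm
    (sub_nonneg.1 (ge_of_tendsto' hgap fun n => (hnonneg n).trans (hle _)))
  rw [ha, sub_self] at hgap
  exact ⟨a, haK.1, fun x hx => (hmax hx).trans_eq ha.symm, fun n => φ n, r ∘ φ,
    fun n => ⟨Nat.cast_nonneg _, hrmax _⟩, hlim, squeeze_zero hnonneg (fun n => hle _) hgap⟩

/-! ### Viscosity solutions on a set of space-time -/

section Partials

variable {E : Type*} [NormedAddCommGroup E] [InnerProductSpace ℝ E] [CompleteSpace E]
  {f g : E × ℝ → ℝ} {q : E × ℝ} {a a' : ℝ} {p p' : E}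

/-- `f : E × ℝ → ℝ` has time derivative `a` and spatial gradient `p` at the point `q` of
space-time. -/
structure HasPartialsAt (f : E × ℝ → ℝ) (a : ℝ) (p : E) (q : E × ℝ) : Prop where
  time : HasDerivAt (fun s => f (q.1, s)) a q.2
  space : HasGradientAt (fun x => f (x, q.2)) p q.1

namespace HasPartialsAt

theorem add (h : HasPartialsAt f a p q) (h' : HasPartialsAt g a' p' q) :
    HasPartialsAt (fun r => f r + g r) (a + a') (p + p') q where
  time := h.time.add h'.time
  space := by
    rw [hasGradientAt_iff_hasFDerivAt, map_add]
    exact h.space.hasFDerivAt.add h'.space.hasFDerivAt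

theorem comp {k : ℝ → ℝ} {k' : ℝ} (hk : HasDerivAt k k' (f q)) (h : HasPartialsAt f a p q) :
    HasPartialsAt (fun r => k (f r)) (k' * a) (k' • p) q where
  time := HasDerivAt.comp q.2 hk h.time
  space := by
    rw [hasGradientAt_iff_hasFDerivAt, map_smul]
    exact HasDerivAt.comp_hasFDerivAt q.1 (f := fun x => f (x, q.2)) hk h.space.hasFDerivAt

theorem const_mul (c : ℝ) (h : HasPartialsAt f a p q) :
    HasPartialsAt (fun r => c * f r) (c * a) (c • p) q :=
  h.comp ((hasDerivAt_id _).const_mul c |>.congr_deriv (mul_one c))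

theorem sub (h : HasPartialsAt f a p q) (h' : HasPartialsAt g a' p' q) :
    HasPartialsAt (fun r => f r - g r) (a - a') (p - p') q := by
  simpa [sub_eq_add_neg] using h.add (h'.const_mul (-1))

theorem of_time {k : ℝ → ℝ} (hk : HasDerivAt k a q.2) : HasPartialsAt (fun r => k r.2) a 0 q where
  time := hk
  space := hasGradientAt_const q.1 (k q.2)

theorem normSq_sub {γ : ℝ → E} {γ' : E} (hγ : HasDerivAt γ γ' q.2) :
    HasPartialsAt (fun r => ‖r.1 - γ r.2‖ ^ 2) (-2 * inner ℝ (q.1 - γ q.2) γ')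
      ((2 : ℝ) • (q.1 - γ q.2)) q where
  time := by
    simpa using (hγ.const_sub q.1).norm_sq
  space := by
    rw [hasGradientAt_iff_hasFDerivAt]
    refine ((hasFDerivAt_id (𝕜 := ℝ) q.1).sub_const (γ q.2)).norm_sq.congr_fderiv ?_
    ext v
    simp

theorem eq_zero_of_isLocalExtr (h : HasPartialsAt f a p q) (hq : IsLocalExtr f q) :
    a = 0 ∧ p = 0 := by
  have ht : IsLocalExtr (fun s => f (q.1, s)) q.2 :=
    hq.comp_tendsto (g := fun s => (q.1, s)) ((Continuous.prodMk_right q.1).tendsto q.2)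
  have hx : IsLocalExtr (fun x => f (x, q.2)) q.1 :=
    hq.comp_tendsto (g := fun x => (x, q.2)) ((Continuous.prodMk_left q.2).tendsto q.1)
  exact ⟨ht.hasDerivAt_eq_zero h.time,
    (map_eq_zero_iff _ (InnerProductSpace.toDual ℝ E).injective).1
      (hx.hasFDerivAt_eq_zero h.space.hasFDerivAt)⟩

end HasPartialsAt

end Partials

section ViscosityOn

variable {E : Type*} [NormedAddCommGroup E] [InnerProductSpace ℝ E] [CompleteSpace E]
  {H H' : E × ℝ → E → ℝ} {D D' : Set (E × ℝ)} {v f : E × ℝ → ℝ}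

/-- Viscosity sub-solutions of `v_t + H(q, ∇v) = 0` at the points `q` of a set `D` of space-time.
The test functions touch from above in a full neighbourhood of `q`, so `D` is meant to be open. -/
def IsViscositySubsolutionOn (D : Set (E × ℝ)) (H : E × ℝ → E → ℝ) (v : E × ℝ → ℝ) : Prop :=
  ∀ ψ : E × ℝ → ℝ, ContDiff ℝ 1 ψ → ∀ q ∈ D, ∀ a p, HasPartialsAt ψ a p q →
    IsLocalMax (fun r => v r - ψ r) q → a + H q p ≤ 0

/-- Viscosity super-solutions of `v_t + H(q, ∇v) = 0` at the points `q` of a set `D` of space-time.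
The test functions touch from below in a full neighbourhood of `q`, so `D` is meant to be open. -/
def IsViscositySupersolutionOn (D : Set (E × ℝ)) (H : E × ℝ → E → ℝ) (v : E × ℝ → ℝ) : Prop :=
  ∀ ψ : E × ℝ → ℝ, ContDiff ℝ 1 ψ → ∀ q ∈ D, ∀ a p, HasPartialsAt ψ a p q →
    IsLocalMin (fun r => v r - ψ r) q → 0 ≤ a + H q p

namespace IsViscositySubsolutionOn

theorem mono (h : IsViscositySubsolutionOn D H v) (hD : D' ⊆ D)
    (hH : ∀ q ∈ D', ∀ p, H' q p ≤ H q p) : IsViscositySubsolutionOn D' H' v :=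
  fun ψ hψ q hq a p hp hmax =>
    (add_le_add_right (hH q hq p) a).trans (h ψ hψ q (hD hq) a p hp hmax)

theorem const_mul_add (h : IsViscositySubsolutionOn D H v) (hf : ContDiff ℝ 1 f) {c : ℝ}
    (hc : 0 < c) (hH : ∀ q ∈ D, ∃ a r, HasPartialsAt f a r q ∧
      ∀ p, a + H' q (c • p + r) ≤ c * H q p) :
    IsViscositySubsolutionOn D H' (fun q => c * v q + f q) := by
  intro ψ hψ q hq a p hp hmax
  obtain ⟨b, r, hb, hbr⟩ := hH q hq
  have hmax' : IsLocalMax (fun x => v x - c⁻¹ * (ψ x - f x)) q := by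
    filter_upwards [hmax] with x hx
    rw [← mul_le_mul_iff_right₀ hc]
    simp only [mul_sub, mul_inv_cancel_left₀ hc.ne']
    linarith
  have hle := h _ (contDiff_const.mul (hψ.sub hf)) q hq _ _ ((hp.sub hb).const_mul c⁻¹) hmax'
  have hbp := hbr (c⁻¹ • (p - r))
  rw [smul_inv_smul₀ hc.ne', sub_add_cancel] at hbp
  have := mul_nonpos_of_nonneg_of_nonpos hc.le hle
  rw [mul_add, mul_inv_cancel_left₀ hc.ne'] at this
  linarith

theorem convexComb (h : IsViscositySubsolutionOn D H v) (hf : ContDiff ℝ 1 f)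
    (hconv : ∀ q ∈ D, ConvexOn ℝ univ (H q))
    (hsub : ∀ q ∈ D, ∃ a r, HasPartialsAt f a r q ∧ a + H q r ≤ 0) {l : ℝ} (hl : 0 ≤ l)
    (hl1 : l < 1) : IsViscositySubsolutionOn D H (fun q => (1 - l) * v q + l * f q) := by
  refine h.const_mul_add (contDiff_const.mul hf) (sub_pos.2 hl1) fun q hq => ?_
  obtain ⟨a, r, hr, har⟩ := hsub q hq
  refine ⟨l * a, l • r, hr.const_mul l, fun p => ?_⟩
  have hH := (hconv q hq).2 (mem_univ p) (mem_univ r) (sub_nonneg.2 hl1.le) hl (sub_add_cancel 1 l)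
  simp only [smul_eq_mul] at hH
  linarith [mul_nonpos_of_nonneg_of_nonpos hl har]

end IsViscositySubsolutionOn

namespace IsViscositySupersolutionOn

theorem mono (h : IsViscositySupersolutionOn D H v) (hD : D' ⊆ D) :
    IsViscositySupersolutionOn D' H v :=
  fun ψ hψ q hq => h ψ hψ q (hD hq)

theorem of_classical (hf : ∀ q ∈ D, ∃ a p, HasPartialsAt f a p q ∧ 0 ≤ a + H q p) :
    IsViscositySupersolutionOn D H f := by
  intro ψ _ q hq a p hp hmin
  obtain ⟨b, r, hb, hbr⟩ := hf q hq
  obtain ⟨h1, h2⟩ := (hb.sub hp).eq_zero_of_isLocalExtr (Or.inl hmin)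
  rwa [sub_eq_zero.1 h1, sub_eq_zero.1 h2] at hbr

theorem comp (h : IsViscositySupersolutionOn D H v)
    (hH : ∀ q ∈ D, ∀ c, 0 < c → ∀ p, H q (c • p) = c * H q p) {Φ : ℝ → ℝ} (hΦ : ContDiff ℝ 1 Φ)
    (hΦ' : ∀ y, 0 < deriv Φ y) : IsViscositySupersolutionOn D H (fun q => Φ (v q)) := by
  intro ψ hψ q hq a p hp hmin
  obtain ⟨g, hg, hg', hΦg⟩ := exists_contDiff_rightInverse hΦ.contDiffAt (hΦ' (v q)).ne'
  set c := Φ (v q) - ψ q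
  have hψc : ContDiff ℝ 1 (fun r => ψ r + c) := hψ.add contDiff_const
  have hψq : ψ q + c = Φ (v q) := add_sub_cancel _ _
  have hpc : HasPartialsAt (fun r => ψ r + c) a p q := by
    simpa using hp.add (.of_time (hasDerivAt_const q.2 c))
  have hvq : g (Φ (v q)) = v q := (strictMono_of_deriv_pos hΦ').injective hΦg.self_of_nhds
  have hmin' : IsLocalMin (fun r => v r - g (ψ r + c)) q := by
    have hnear : ∀ᶠ r in 𝓝 q, Φ (g (ψ r + c)) = ψ r + c :=
      hψc.continuous.continuousAt.eventually (hψq ▸ hΦg)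
    filter_upwards [hmin, hnear] with r hr hrg
    have hle : g (ψ r + c) ≤ v r :=
      (strictMono_of_deriv_pos hΦ').le_iff_le.1 (by rw [hrg]; linarith)
    simpa only [hψq, hvq, sub_self, sub_nonneg] using hle
  have hineq := h _ (hg.comp hψc) q hq _ _ (hpc.comp (hψq ▸ hg')) hmin'
  have hd : 0 < (deriv Φ (v q))⁻¹ := inv_pos.2 (hΦ' _)
  rw [hH q hq _ hd, ← mul_add] at hineq
  exact nonneg_of_mul_nonneg_right hineq hd

end IsViscositySupersolutionOn

end ViscosityOn

/-! ### The doubling of variables -/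

section Comparison

variable {E : Type*} [NormedAddCommGroup E]

/-- The squared Euclidean distance of two points of space-time, the penalty in the doubling of
variables. -/
def spacetimeDistSq (X Y : E × ℝ) : ℝ := ‖X.1 - Y.1‖ ^ 2 + (X.2 - Y.2) ^ 2

theorem spacetimeDistSq_nonneg (X Y : E × ℝ) : 0 ≤ spacetimeDistSq X Y :=
  add_nonneg (sq_nonneg _) (sq_nonneg _)

theorem spacetimeDistSq_eq_zero {X Y : E × ℝ} : spacetimeDistSq X Y = 0 ↔ X = Y := by
  rw [spacetimeDistSq, add_eq_zero_iff_of_nonneg (sq_nonneg _) (sq_nonneg _), sq_eq_zero_iff,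
    sq_eq_zero_iff, norm_eq_zero, sub_eq_zero, sub_eq_zero, Prod.ext_iff]

theorem spacetimeDistSq_comm (X Y : E × ℝ) : spacetimeDistSq X Y = spacetimeDistSq Y X := by
  rw [spacetimeDistSq, spacetimeDistSq, norm_sub_rev, sub_sq_comm]

theorem dist_mul_norm_sub_le_spacetimeDistSq (X Y : E × ℝ) :
    dist X Y * ‖X.1 - Y.1‖ ≤ spacetimeDistSq X Y := by
  rw [Prod.dist_eq, dist_eq_norm, Real.dist_eq, spacetimeDistSq, ← sq_abs (X.2 - Y.2)]
  rcases max_cases ‖X.1 - Y.1‖ |X.2 - Y.2| with ⟨h, _⟩ | ⟨h, _⟩ <;> rw [h] <;>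
    nlinarith [norm_nonneg (X.1 - Y.1), abs_nonneg (X.2 - Y.2)]

variable [InnerProductSpace ℝ E]

theorem contDiff_spacetimeDistSq (Y : E × ℝ) : ContDiff ℝ 1 (spacetimeDistSq · Y) :=
  ((contDiff_fst.sub contDiff_const).norm_sq ℝ).add ((contDiff_snd.sub contDiff_const).pow 2)

variable [CompleteSpace E] {H : E × ℝ → E → ℝ} {K : Set (E × ℝ)} {U V f : E × ℝ → ℝ} {L : NNReal}
  {c : ℝ}

theorem hasPartialsAt_spacetimeDistSq (X Y : E × ℝ) :
    HasPartialsAt (spacetimeDistSq · Y) (2 * (X.2 - Y.2)) ((2 : ℝ) • (X.1 - Y.1)) X := by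
  have ht : HasDerivAt (fun s => (s - Y.2) ^ 2) (2 * (X.2 - Y.2)) X.2 := by
    simpa using ((hasDerivAt_id X.2).sub_const Y.2).fun_pow 2
  simpa [spacetimeDistSq] using
    (HasPartialsAt.normSq_sub (hasDerivAt_const X.2 Y.1)).add (.of_time ht)

theorem le_of_isMaxOn_doubled {η N : ℝ} (hN : 0 ≤ N)
    (hH : ∀ p, LipschitzOnWith (L * ‖p‖₊) (fun q => H q p) (interior K))
    (hU : IsViscositySubsolutionOn (interior K) (fun q p => H q p + η) U)
    (hV : IsViscositySupersolutionOn (interior K) H V) {X Y : E × ℝ} (hX : X ∈ interior K)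
    (hY : Y ∈ interior K)
    (hmax : IsMaxOn (fun r => U r.1 - V r.2 - N * spacetimeDistSq r.1 r.2) (K ×ˢ K) (X, Y)) :
    η ≤ 2 * L * (N * spacetimeDistSq X Y) := by
  have hUX : IsLocalMax (fun q => U q - N * spacetimeDistSq q Y) X := by
    filter_upwards [mem_interior_iff_mem_nhds.1 hX] with q hq
    linarith [show U q - V Y - N * _ ≤ U X - V Y - N * _ from
      hmax (mk_mem_prod hq (interior_subset hY))]
  have hVY : IsLocalMin (fun q => V q - -N * spacetimeDistSq q X) Y := by
    filter_upwards [mem_interior_iff_mem_nhds.1 hY] with q hq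
    rw [spacetimeDistSq_comm q, spacetimeDistSq_comm Y]
    linarith [show U X - V q - N * _ ≤ U X - V Y - N * _ from
      hmax (mk_mem_prod (interior_subset hX) hq)]
  have hsub := hU _ (contDiff_const.mul (contDiff_spacetimeDistSq Y)) X hX _ _
    ((hasPartialsAt_spacetimeDistSq X Y).const_mul N) hUX
  have hsup := hV _ (contDiff_const.mul (contDiff_spacetimeDistSq X)) Y hY _ _
    ((hasPartialsAt_spacetimeDistSq Y X).const_mul (-N)) hVY
  set p : E := N • (2 : ℝ) • (X.1 - Y.1) with hp
  have hpY : -N • (2 : ℝ) • (Y.1 - X.1) = p := by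
    rw [hp, neg_smul, ← smul_neg, ← smul_neg, neg_sub]
  have hpnorm : ‖p‖ = 2 * N * ‖X.1 - Y.1‖ := by
    rw [hp, norm_smul, norm_smul, Real.norm_of_nonneg hN, Real.norm_two]
    ring
  rw [hpY] at hsup
  have hLip : H Y p - H X p ≤ L * ‖p‖ * dist Y X :=
    (le_abs_self _).trans ((hH p).dist_le_mul Y hY X hX)
  calc η ≤ L * ‖p‖ * dist Y X := by linarith
    _ = 2 * L * (N * (dist X Y * ‖X.1 - Y.1‖)) := by rw [hpnorm, dist_comm]; ring
    _ ≤ 2 * L * (N * spacetimeDistSq X Y) := by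
      gcongr
      exact dist_mul_norm_sub_le_spacetimeDistSq X Y

theorem le_add_of_frontier_of_strict {η : ℝ} (hη : 0 < η) (hK : IsCompact K)
    (hH : ∀ p, LipschitzOnWith (L * ‖p‖₊) (fun q => H q p) (interior K))
    (hUc : ContinuousOn U K) (hVc : ContinuousOn V K)
    (hU : IsViscositySubsolutionOn (interior K) (fun q p => H q p + η) U)
    (hV : IsViscositySupersolutionOn (interior K) H V)
    (hUV : ∀ q ∈ frontier K, U q ≤ V q + c) {q : E × ℝ} (hq : q ∈ K) : U q ≤ V q + c := by
  by_contra! hcon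
  obtain ⟨a, haK, ha, N, r, hNr, hra, hND⟩ :=
    exists_tendsto_isMaxOn_doubled (D := fun r : (E × ℝ) × (E × ℝ) => spacetimeDistSq r.1 r.2) hK
      ⟨q, hq⟩ hUc hVc (by unfold spacetimeDistSq; fun_prop) (fun r => spacetimeDistSq_nonneg _ _)
      fun r => spacetimeDistSq_eq_zero
  have hmax : U q - V q ≤ U a - V a := ha hq
  have hint : a ∈ interior K := by
    by_contra hnot
    have := hUV a (hK.isClosed.frontier_eq ▸ ⟨haK, hnot⟩)
    linarith
  have hr1 := ((continuous_fst.tendsto _).comp hra).eventually (isOpen_interior.mem_nhds hint)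
  have hr2 := ((continuous_snd.tendsto _).comp hra).eventually (isOpen_interior.mem_nhds hint)
  have hsmall := (hND.const_mul (2 * L : ℝ)).eventually_lt_const (by rwa [mul_zero])
  obtain ⟨n, hn1, hn2, hn⟩ := (hr1.and (hr2.and hsmall)).exists
  exact hn.not_ge (le_of_isMaxOn_doubled (hNr n).1 hH hU hV hn1 hn2 (hNr n).2)

theorem le_add_of_frontier (hK : IsCompact K)
    (hH : ∀ p, LipschitzOnWith (L * ‖p‖₊) (fun q => H q p) (interior K))
    (hUc : ContinuousOn U K) (hVc : ContinuousOn V K)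
    (hU : IsViscositySubsolutionOn (interior K) H U)
    (hV : IsViscositySupersolutionOn (interior K) H V)
    (hUV : ∀ q ∈ frontier K, U q ≤ V q + c) {q : E × ℝ} (hq : q ∈ K) : U q ≤ V q + c := by
  obtain ⟨S, hS⟩ := (hK.image continuous_snd).isBounded.subset_closedBall 0
  have hSK : ∀ r ∈ K, |r.2| ≤ S := fun r hr => by
    simpa using hS (mem_image_of_mem _ hr)
  have hη : ∀ᶠ η : ℝ in 𝓝[>] 0, U q ≤ V q + c + η * (S + S) := by
    filter_upwards [self_mem_nhdsWithin] with η (hη : 0 < η)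
    have hstrict : IsViscositySubsolutionOn (interior K) (fun q p => H q p + η)
        (fun r => 1 * U r + -η * r.2) :=
      hU.const_mul_add (contDiff_const.mul contDiff_snd) one_pos fun r _ =>
        ⟨_, _, (HasPartialsAt.of_time (hasDerivAt_id r.2)).const_mul (-η), fun p => by simp⟩
    have hle := le_add_of_frontier_of_strict hη hK hH (by fun_prop) hVc hstrict hV (c := c + η * S)
      (fun r hr => by
        nlinarith [hUV r hr, abs_le.1 (hSK r (hK.isClosed.frontier_subset hr))]) hq
    nlinarith [abs_le.1 (hSK q hq)]
  refine ge_of_tendsto (x := 𝓝[>] (0 : ℝ)) ?_ hη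
  exact (Continuous.tendsto' (by fun_prop) 0 _ (by simp)).mono_left nhdsWithin_le_nhds

theorem le_add_of_frontier_of_penalty (hK : IsCompact K)
    (hH : ∀ p, LipschitzOnWith (L * ‖p‖₊) (fun q => H q p) (interior K))
    (hUc : ContinuousOn U K) (hVc : ContinuousOn V K)
    (hU : IsViscositySubsolutionOn (interior K) H U)
    (hV : IsViscositySupersolutionOn (interior K) H V) (hf : ContDiff ℝ 1 f)
    (hfH : ∀ q ∈ interior K, ∃ a r, HasPartialsAt f a r q ∧
      ∀ p, ∀ b, 0 ≤ b → H q (p - b • r) ≤ H q p + b * a)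
    (hUV : ∀ q ∈ frontier K, f q ≤ 0 → U q ≤ V q + c) {q : E × ℝ} (hq : q ∈ K) (hfq : f q ≤ 0) :
    U q ≤ V q + c := by
  have hfr : frontier K ⊆ K := hK.isClosed.frontier_subset
  have hη : ∀ᶠ η : ℝ in 𝓝[>] 0, U q ≤ V q + c + η := by
    filter_upwards [self_mem_nhdsWithin] with η (hη : 0 < η)
    obtain ⟨k, hk, hkf⟩ := exists_le_mul_exp (hK.of_isClosed_subset isClosed_frontier hfr)
      hf.continuous.continuousOn (((hUc.sub hVc).sub continuousOn_const).mono hfr)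
      (h := fun q => U q - V q - c) (fun r hr hfr => by linarith [hUV r hr hfr]) hη
    have hpen : IsViscositySubsolutionOn (interior K) H
        (fun r => 1 * U r + -η * Real.exp (k * f r)) := by
      refine hU.const_mul_add (by fun_prop) one_pos fun r hr => ?_
      obtain ⟨a, x, hax, hHx⟩ := hfH r hr
      refine ⟨_, _, ((hax.const_mul k).comp (Real.hasDerivAt_exp _)).const_mul (-η), fun p => ?_⟩
      have := hHx p (η * (Real.exp (k * f r) * k)) (by positivity)
      simp only [one_smul, smul_smul, neg_mul, neg_smul, ← sub_eq_add_neg]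
      linarith
    have hle := le_add_of_frontier hK hH
      (by have := hf.continuous; fun_prop) hVc hpen hV (c := c)
      (fun r hr => by linarith [hkf r hr]) hq
    have hexp : Real.exp (k * f q) ≤ 1 :=
      Real.exp_le_one_iff.2 (mul_nonpos_of_nonneg_of_nonpos hk.le hfq)
    nlinarith
  refine ge_of_tendsto (x := 𝓝[>] (0 : ℝ)) ?_ hη
  exact (Continuous.tendsto' (by fun_prop) 0 _ (by simp)).mono_left nhdsWithin_le_nhds

end Comparison

/-- The space-time domain `E × (0, ∞)` of the equations. -/
abbrev openHalf (E : Type*) : Set (E × ℝ) := univ ×ˢ Ioi 0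

section Tube

variable {E : Type*} [NormedAddCommGroup E] {γ : ℝ → E} {R σ T : ℝ}

/-- The space-time cylinder of radius `R` around a moving centre `γ`, over the times `[σ, T]`. -/
def tube (γ : ℝ → E) (R σ T : ℝ) : Set (E × ℝ) := {q | ‖q.1 - γ q.2‖ ≤ R ∧ q.2 ∈ Icc σ T}

theorem isCompact_tube [ProperSpace E] (hγ : Continuous γ) : IsCompact (tube γ R σ T) := by
  have himage : tube γ R σ T =
      (fun q : E × ℝ => (q.1 + γ q.2, q.2)) '' (Metric.closedBall 0 R ×ˢ Icc σ T) := by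
    ext ⟨x, s⟩
    constructor
    · exact fun ⟨hx, hs⟩ => ⟨(x - γ s, s), ⟨mem_closedBall_zero_iff.2 hx, hs⟩, by simp⟩
    · rintro ⟨⟨y, r⟩, ⟨hy, hr⟩, heq⟩
      obtain ⟨rfl, rfl⟩ := Prod.mk.inj heq
      exact ⟨by simpa using hy, hr⟩
  rw [himage]
  exact ((isCompact_closedBall 0 R).prod isCompact_Icc).image (by fun_prop)

theorem eq_of_mem_frontier_tube [ProperSpace E] (hγ : Continuous γ) {q : E × ℝ}
    (hq : q ∈ frontier (tube γ R σ T)) : ‖q.1 - γ q.2‖ = R ∨ q.2 = σ ∨ q.2 = T := by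
  rw [(isCompact_tube hγ).isClosed.frontier_eq] at hq
  obtain ⟨⟨hR, hσ, hT⟩, hint⟩ := hq
  by_contra! hne
  have hopen : IsOpen ({q : E × ℝ | ‖q.1 - γ q.2‖ < R} ∩ Prod.snd ⁻¹' Ioo σ T) :=
    (isOpen_lt (by fun_prop) continuous_const).inter (isOpen_Ioo.preimage continuous_snd)
  exact hint <| mem_interior.2 ⟨_, fun r hr => ⟨le_of_lt hr.1, Ioo_subset_Icc_self hr.2⟩, hopen,
    hR.lt_of_ne hne.1, hσ.lt_of_ne' hne.2.1, hT.lt_of_ne hne.2.2⟩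

theorem tube_subset_openHalf (hσ : 0 < σ) : tube γ R σ T ⊆ openHalf E :=
  fun _ hq => ⟨mem_univ _, hσ.trans_le hq.2.1⟩

theorem le_add_of_parabolicBoundary [InnerProductSpace ℝ E] [ProperSpace E]
    {H : E × ℝ → E → ℝ} {U V : E × ℝ → ℝ} {L : NNReal} {c : ℝ} (hγ : Continuous γ)
    (hH : ∀ p, LipschitzOnWith (L * ‖p‖₊) (fun q => H q p) (tube γ R σ T))
    (hUc : ContinuousOn U (tube γ R σ T)) (hVc : ContinuousOn V (tube γ R σ T))
    (hU : IsViscositySubsolutionOn (tube γ R σ T) H U)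
    (hV : IsViscositySupersolutionOn (tube γ R σ T) H V) {x : E} {t : ℝ} (ht : t ∈ Ico σ T)
    (hbottom : ∀ y, ‖y - γ σ‖ ≤ R → U (y, σ) ≤ V (y, σ) + c)
    (hlateral : ∀ y, ∀ s ∈ Icc σ t, ‖y - γ s‖ = R → U (y, s) ≤ V (y, s) + c)
    (hx : ‖x - γ t‖ ≤ R) : U (x, t) ≤ V (x, t) + c := by
  have hK : IsCompact (tube γ R σ T) := isCompact_tube hγ
  refine le_add_of_frontier_of_penalty (f := fun q => q.2 - t) hK
    (fun p => (hH p).mono interior_subset) hUc hVc (hU.mono interior_subset fun _ _ _ => le_rfl)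
    (hV.mono interior_subset) (by fun_prop)
    (fun q _ => ⟨1, 0, .of_time ((hasDerivAt_id q.2).sub_const t), fun p b hb => by simpa using hb⟩)
    ?_ ⟨hx, ht.1, ht.2.le⟩ (sub_self t).le
  rintro ⟨y, s⟩ hq hs
  have hmem := hK.isClosed.frontier_subset hq
  rcases eq_of_mem_frontier_tube hγ hq with h | h | h
  · exact hlateral y s ⟨hmem.2.1, sub_nonpos.1 hs⟩ h
  · obtain rfl : s = σ := h
    exact hbottom y hmem.1
  · exact absurd (sub_nonpos.1 hs) (not_le.2 (h.symm ▸ ht.2))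

end Tube

/-! ### Comparison for the eikonal equation -/

section Drift

variable {E : Type*} [NormedAddCommGroup E] [InnerProductSpace ℝ E] {b : E × ℝ → E}

/-- The Hamiltonian `b · p + F(p)` of an equation with drift `b`. -/
noncomputable def driftHamiltonian (b : E × ℝ → E) (F : E → ℝ) (q : E × ℝ) (p : E) : ℝ :=
  inner ℝ (b q) p + F p

/-- The Hamiltonian `b · p + |p|` of the G-equation with drift `b`. -/
noncomputable abbrev geometricHamiltonian (b : E × ℝ → E) : E × ℝ → E → ℝ :=
  driftHamiltonian b fun p => ‖p‖

/-- The Hamiltonian `b · p + |p|² / 2 + 1 / 2` of the eikonal equation with drift `b`. -/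
noncomputable abbrev eikonalHamiltonian (b : E × ℝ → E) : E × ℝ → E → ℝ :=
  driftHamiltonian b fun p => ‖p‖ ^ 2 / 2 + 1 / 2

theorem lipschitzOnWith_driftHamiltonian {L : NNReal} {D : Set (E × ℝ)}
    (hb : LipschitzOnWith L b D) (F : E → ℝ) (p : E) :
    LipschitzOnWith (L * ‖p‖₊) (fun q => driftHamiltonian b F q p) D := by
  refine LipschitzOnWith.of_dist_le_mul fun q hq q' hq' => ?_
  calc dist (driftHamiltonian b F q p) (driftHamiltonian b F q' p)
      = |inner ℝ (b q - b q') p| := by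
        rw [Real.dist_eq, driftHamiltonian, driftHamiltonian, add_sub_add_right_eq_sub,
          inner_sub_left]
    _ ≤ dist (b q) (b q') * ‖p‖ := by
        rw [dist_eq_norm]
        exact abs_real_inner_le_norm _ _
    _ ≤ L * dist q q' * ‖p‖ := by
        gcongr
        exact hb.dist_le_mul q hq q' hq'
    _ = (L * ‖p‖₊ : NNReal) * dist q q' := by
        push_cast
        ring

theorem convexOn_eikonalHamiltonian (q : E × ℝ) : ConvexOn ℝ univ (eikonalHamiltonian b q) := by
  have hsq : ConvexOn ℝ univ fun p : E => ‖p‖ ^ 2 :=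
    convexOn_univ_norm.pow (fun _ _ => norm_nonneg _) 2
  have hlin : ConvexOn ℝ univ fun p : E => inner ℝ (b q) p :=
    (innerₛₗ ℝ (b q)).convexOn convex_univ
  refine (hlin.add ((hsq.smul (c := 1 / 2) (by positivity)).add_const (1 / 2))).congr
    fun p _ => ?_
  simp only [driftHamiltonian, smul_eq_mul, Pi.add_apply]
  ring

theorem geometricHamiltonian_le_eikonalHamiltonian (q : E × ℝ) (p : E) :
    geometricHamiltonian b q p ≤ eikonalHamiltonian b q p :=
  add_le_add_right (by linarith [sq_nonneg (‖p‖ - 1)]) _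

theorem geometricHamiltonian_smul (q : E × ℝ) {c : ℝ} (hc : 0 < c) (p : E) :
    geometricHamiltonian b q (c • p) = c * geometricHamiltonian b q p := by
  simp only [driftHamiltonian, inner_smul_right, norm_smul, Real.norm_of_nonneg hc.le, mul_add]

end Drift

section Eikonal

variable {E : Type*} [NormedAddCommGroup E] [InnerProductSpace ℝ E]
  {b : E × ℝ → E} {B : ℝ} {L : NNReal} {v : E × ℝ → ℝ}

theorem eikonalHamiltonian_add_nonneg {q : E × ℝ} (hb : ‖b q‖ ≤ B) (e p : E) :
    0 ≤ (B + ‖e‖) ^ 2 / 2 - inner ℝ e p + eikonalHamiltonian b q p := by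
  have hdrift : -((B + ‖e‖) * ‖p‖) ≤ inner ℝ (b q - e) p :=
    (neg_le_neg (mul_le_mul_of_nonneg_right ((norm_sub_le _ _).trans (add_le_add_left hb _))
      (norm_nonneg p))).trans (neg_le_of_abs_le (abs_real_inner_le_norm _ _))
  rw [inner_sub_left] at hdrift
  simp only [driftHamiltonian]
  nlinarith [sq_nonneg (B + ‖e‖ - ‖p‖)]

theorem hasPartialsAt_lineBarrier [CompleteSpace E] (A κ s : ℝ) (z e : E) (q : E × ℝ) :
    HasPartialsAt (fun r : E × ℝ => A * ‖r.1 - (z + (r.2 - s) • e)‖ ^ 2 + κ * (r.2 - s))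
      (κ - inner ℝ e ((2 * A) • (q.1 - (z + (q.2 - s) • e))))
      ((2 * A) • (q.1 - (z + (q.2 - s) • e))) q := by
  have hline : HasDerivAt (fun r => z + (r - s) • e) e q.2 := by
    simpa using (((hasDerivAt_id q.2).sub_const s).smul_const e).const_add z
  have htime : HasDerivAt (fun r => κ * (r - s)) κ q.2 := by
    simpa using ((hasDerivAt_id q.2).sub_const s).const_mul κ
  convert ((HasPartialsAt.normSq_sub hline).const_mul A).add (.of_time htime) using 1
  · rw [inner_smul_right, real_inner_comm]
    ring
  · rw [smul_smul, add_zero, mul_comm]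

variable [ProperSpace E]

/-- Comparison, in a thin tube around the line, with `A ‖x - γ(r)‖² + κ (r - s)`, where `γ` runs
along the line and `κ` is the supremum of the Lagrangian at velocity `e`. -/
theorem IsViscositySubsolutionOn.le_along_line (hb : ∀ q ∈ openHalf E, ‖b q‖ ≤ B)
    (hbL : LipschitzOnWith L b (openHalf E))
    (hv : IsViscositySubsolutionOn (openHalf E) (eikonalHamiltonian b) v)
    (hvc : ContinuousOn v (openHalf E)) {s t : ℝ} (hs : 0 < s) (hst : s ≤ t) (z e : E) :
    v (z + (t - s) • e, t) ≤ v (z, s) + (B + ‖e‖) ^ 2 / 2 * (t - s) := by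
  set γ : ℝ → E := fun r => z + (r - s) • e with hγ
  have hγs : γ s = z := by simp [hγ]
  have hγc : Continuous γ := by fun_prop
  refine le_of_forall_pos_le_add fun η hη => ?_
  obtain ⟨δ, hδ, hball⟩ : ∃ δ > 0, ∀ y, ‖y - z‖ ≤ δ → v (y, s) ≤ v (z, s) + η := by
    have hvz : ContinuousAt (fun y => v (y, s)) z :=
      (hvc.continuousAt (x := (z, s))
        ((isOpen_univ.prod isOpen_Ioi).mem_nhds ⟨mem_univ z, hs⟩)).comp
          (f := fun y => (y, s)) (by fun_prop)
    obtain ⟨δ, hδ, h⟩ := Metric.nhds_basis_closedBall.eventually_iff.1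
      (hvz.eventually_le_const (lt_add_of_pos_right _ hη))
    exact ⟨δ, hδ, fun y hy => h (mem_closedBall_iff_norm.2 hy)⟩
  have hsub : tube γ δ s (t + 1) ⊆ openHalf E := tube_subset_openHalf hs
  obtain ⟨M, hM⟩ := (isCompact_tube hγc).bddAbove_image (hvc.mono hsub)
  set A := |M - (v (z, s) + η)| / δ ^ 2 with hA
  set W : E × ℝ → ℝ := fun q => A * ‖q.1 - γ q.2‖ ^ 2 + (B + ‖e‖) ^ 2 / 2 * (q.2 - s) with hW
  have : 0 ≤ A := by positivity
  have hWsup : IsViscositySupersolutionOn (openHalf E) (eikonalHamiltonian b) W :=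
    .of_classical fun q hq => ⟨_, _, hasPartialsAt_lineBarrier _ _ _ _ _ _,
      eikonalHamiltonian_add_nonneg (hb q hq) _ _⟩
  have hle := le_add_of_parabolicBoundary (c := v (z, s) + η) hγc
    (fun p => (lipschitzOnWith_driftHamiltonian hbL _ p).mono hsub) (hvc.mono hsub)
    (show Continuous W by fun_prop).continuousOn (hv.mono hsub fun _ _ _ => le_rfl)
    (hWsup.mono hsub) (x := γ t) (t := t) ⟨hst, lt_add_one t⟩ (fun y hy => ?_)
    (fun y r hr hy => ?_) (by simpa using hδ.le)
  · simp only [hW, sub_self, norm_zero] at hle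
    linarith
  · have h0 : 0 ≤ W (y, s) := by simp only [hW, sub_self]; positivity
    linarith [hball y (hγs ▸ hy)]
  · have hvM : v (y, r) ≤ M :=
      hM (mem_image_of_mem v ⟨hy.le, hr.1, hr.2.trans (le_add_of_nonneg_right zero_le_one)⟩)
    have hWr : |M - (v (z, s) + η)| ≤ W (y, r) := by
      simp only [hW, hy, hA, div_mul_cancel₀ _ (pow_pos hδ 2).ne']
      exact le_add_of_nonneg_right (mul_nonneg (by positivity) (sub_nonneg.2 hr.1))
    linarith [le_abs_self (M - (v (z, s) + η))]

theorem IsViscositySubsolutionOn.exists_neg_sub_normSq_le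
    (hb : ∀ q ∈ openHalf E, ‖b q‖ ≤ B) (hbL : LipschitzOnWith L b (openHalf E))
    (hv : IsViscositySubsolutionOn (openHalf E) (eikonalHamiltonian b) v)
    (hvc : ContinuousOn v (openHalf E)) {δ : ℝ} (hδ : 0 < δ) (T : ℝ) :
    ∃ M, ∀ x, ∀ s ∈ Ioc 0 T, -M - δ * ‖x‖ ^ 2 ≤ v (x, s) := by
  refine ⟨B ^ 2 * (T + δ⁻¹) - v (0, T + δ⁻¹), fun x s hs => ?_⟩
  have hτ : δ⁻¹ ≤ T + δ⁻¹ - s := by linarith [hs.2]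
  have hτ0 : 0 < T + δ⁻¹ - s := (inv_pos.2 hδ).trans_le hτ
  have hline := hv.le_along_line hb hbL hvc hs.1 (sub_pos.1 hτ0).le x (-(T + δ⁻¹ - s)⁻¹ • x)
  rw [smul_smul, mul_neg, mul_inv_cancel₀ hτ0.ne', neg_one_smul, add_neg_cancel, norm_smul,
    norm_neg, norm_inv, Real.norm_of_nonneg hτ0.le] at hline
  have hcost : ∀ τ, 0 < τ → (B + τ⁻¹ * ‖x‖) ^ 2 / 2 * τ ≤ B ^ 2 * τ + τ⁻¹ * ‖x‖ ^ 2 :=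
    fun τ hτ => by
      calc (B + τ⁻¹ * ‖x‖) ^ 2 / 2 * τ ≤ (B ^ 2 + (τ⁻¹ * ‖x‖) ^ 2) * τ := by
            gcongr
            linarith [sq_nonneg (B - τ⁻¹ * ‖x‖)]
        _ = B ^ 2 * τ + τ⁻¹ * ‖x‖ ^ 2 := by field_simp
  have hlate : B ^ 2 * (T + δ⁻¹ - s) ≤ B ^ 2 * (T + δ⁻¹) := by gcongr; linarith [hs.1]
  have hδτ : (T + δ⁻¹ - s)⁻¹ * ‖x‖ ^ 2 ≤ δ * ‖x‖ ^ 2 := by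
    gcongr; exact inv_le_of_inv_le₀ hδ hτ
  linarith [hcost _ hτ0]

end Eikonal

section InitialComparison

variable {E : Type*} [NormedAddCommGroup E]

/-- `f ≤ g` at time `0⁺`, up to errors that vanish locally uniformly in space. -/
def InitiallyLE (f g : E × ℝ → ℝ) : Prop :=
  ∀ C : Set E, IsCompact C → ∀ η > 0, ∀ᶠ s in 𝓝[>] (0 : ℝ), ∀ x ∈ C, f (x, s) ≤ g (x, s) + η

theorem InitiallyLE.trans {f g h : E × ℝ → ℝ} (hfg : InitiallyLE f g) (hgh : InitiallyLE g h) :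
    InitiallyLE f h := fun C hC η hη => by
  filter_upwards [hfg C hC _ (half_pos hη), hgh C hC _ (half_pos hη)] with s hs hs' x hx
  linarith [hs x hx, hs' x hx]

theorem InitiallyLE.convexComb {f g h : E × ℝ → ℝ} (hf : InitiallyLE f h)
    (hg : ∀ x s, 0 ≤ s → g (x, s) ≤ h (x, s)) {l : ℝ} (hl : 0 ≤ l) (hl1 : l ≤ 1) :
    InitiallyLE (fun q => (1 - l) * f q + l * g q) h := by
  intro C hC η hη
  filter_upwards [hf C hC η hη, self_mem_nhdsWithin] with s hs hs0 x hx
  have hfs := mul_le_mul_of_nonneg_left (hs x hx) (sub_nonneg.2 hl1)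
  have hgs := mul_le_mul_of_nonneg_left (hg x s (le_of_lt hs0)) hl
  linarith [mul_nonneg hl hη.le]

theorem InitiallyLE.exists_mem_Ioo {f g : E × ℝ → ℝ} (h : InitiallyLE f g) {C : Set E}
    (hC : IsCompact C) {η t : ℝ} (hη : 0 < η) (ht : 0 < t) :
    ∃ s ∈ Ioo 0 t, ∀ x ∈ C, f (x, s) ≤ g (x, s) + η :=
  ((eventually_mem_set.2 (Ioo_mem_nhdsGT ht)).and (h C hC η hη)).exists

theorem InitiallyLE.le_of_le_at_infinity [InnerProductSpace ℝ E] [ProperSpace E]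
    {H : E × ℝ → E → ℝ} {U V : E × ℝ → ℝ} {L : NNReal} {R T : ℝ} (h : InitiallyLE U V)
    (hH : ∀ p, LipschitzOnWith (L * ‖p‖₊) (fun q => H q p) (univ ×ˢ Ioo 0 T))
    (hUc : ContinuousOn U (univ ×ˢ Ioo 0 T)) (hVc : ContinuousOn V (univ ×ˢ Ioo 0 T))
    (hU : IsViscositySubsolutionOn (univ ×ˢ Ioo 0 T) H U)
    (hV : IsViscositySupersolutionOn (univ ×ˢ Ioo 0 T) H V)
    (hfar : ∀ x, R ≤ ‖x‖ → ∀ s ∈ Ioo 0 T, U (x, s) ≤ V (x, s)) (z : E) {t : ℝ}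
    (ht : t ∈ Ioo 0 T) : U (z, t) ≤ V (z, t) := by
  refine le_of_forall_pos_le_add fun η hη => ?_
  obtain ⟨σ, hσ, hσUV⟩ := h.exists_mem_Ioo (isCompact_closedBall 0 (max R ‖z‖)) hη ht.1
  obtain ⟨T', htT', hT'⟩ := exists_between ht.2
  have hsub : tube (fun _ => (0 : E)) (max R ‖z‖) σ T' ⊆ univ ×ˢ Ioo 0 T :=
    fun _ hq => ⟨mem_univ _, hσ.1.trans_le hq.2.1, hq.2.2.trans_lt hT'⟩
  refine le_add_of_parabolicBoundary (γ := fun _ => 0) continuous_const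
    (fun p => (hH p).mono hsub) (hUc.mono hsub) (hVc.mono hsub) (hU.mono hsub fun _ _ _ => le_rfl)
    (hV.mono hsub) ⟨hσ.2.le, htT'⟩ (fun y hy => ?_) (fun y s hs hy => ?_) (by simp)
  · exact hσUV y (mem_closedBall_iff_norm.2 hy)
  · have hRy : R ≤ ‖y‖ := (le_max_left R ‖z‖).trans (by rw [← hy, sub_zero])
    exact (hfar y hRy s ⟨hσ.1.trans_le hs.1, hs.2.trans_lt ht.2⟩).trans
      (le_add_of_nonneg_right hη.le)

end InitialComparison

section Subquadratic

variable {E : Type*} [NormedAddCommGroup E]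

/-- Growth slower than any multiple of `‖x‖²`, the class in which the eikonal equation has a
comparison principle. -/
def IsSubquadratic (f : E → ℝ) : Prop := ∀ δ > 0, ∃ M, ∀ x, |f x| ≤ M + δ * ‖x‖ ^ 2

theorem isSubquadratic_of_lipschitzWith {f : E → ℝ} {K : NNReal} (hf : LipschitzWith K f) :
    IsSubquadratic f := by
  refine fun δ hδ => ⟨|f 0| + K ^ 2 / (4 * δ), fun x => ?_⟩
  have hlip : |f x| ≤ |f 0| + K * ‖x‖ := by
    have := hf.dist_le_mul x 0
    rw [Real.dist_eq, dist_zero_right] at this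
    linarith [abs_sub_abs_le_abs_sub (f x) (f 0)]
  have hamgm : K * ‖x‖ ≤ K ^ 2 / (4 * δ) + δ * ‖x‖ ^ 2 := by
    have hsq : K ^ 2 / (4 * δ) + δ * ‖x‖ ^ 2 - K * ‖x‖ = (K - 2 * δ * ‖x‖) ^ 2 / (4 * δ) := by
      field_simp
      ring
    exact sub_nonneg.1 (hsq ▸ by positivity)
  linarith

/-- The classical sub-solution of the eikonal equation that is mixed into a sub-solution to make it
small at infinity. -/
noncomputable def quadraticBarrier (M δ κ : ℝ) (q : E × ℝ) : ℝ :=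
  -M - δ * Real.exp (κ * q.2) * (1 + ‖q.1‖ ^ 2) - q.2 / 2

theorem quadraticBarrier_le {M δ κ : ℝ} (hδ : 0 ≤ δ) (hκ : 0 ≤ κ) (x : E) {s : ℝ} (hs : 0 ≤ s) :
    quadraticBarrier M δ κ (x, s) ≤ -M - δ * ‖x‖ ^ 2 := by
  have hexp : δ * ‖x‖ ^ 2 ≤ δ * Real.exp (κ * s) * (1 + ‖x‖ ^ 2) := by
    gcongr
    · exact le_mul_of_one_le_right hδ (Real.one_le_exp (by positivity))
    · exact le_add_of_nonneg_left zero_le_one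
  simp only [quadraticBarrier]
  linarith

variable [InnerProductSpace ℝ E]

theorem contDiff_quadraticBarrier (M δ κ : ℝ) :
    ContDiff ℝ 1 (quadraticBarrier M δ κ : E × ℝ → ℝ) := by
  have hsq : ContDiff ℝ 1 fun q : E × ℝ => ‖q.1‖ ^ 2 := contDiff_fst.norm_sq ℝ
  unfold quadraticBarrier
  fun_prop

variable [CompleteSpace E]

theorem hasPartialsAt_quadraticBarrier (M δ κ : ℝ) (q : E × ℝ) :
    HasPartialsAt (quadraticBarrier M δ κ)
      (-(κ * (δ * Real.exp (κ * q.2) * (1 + ‖q.1‖ ^ 2))) - 1 / 2)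
      (-(2 * (δ * Real.exp (κ * q.2))) • q.1) q where
  time := by
    have hexp : HasDerivAt (fun s => Real.exp (κ * s)) (Real.exp (κ * q.2) * κ) q.2 := by
      simpa using ((hasDerivAt_id q.2).const_mul κ).exp
    refine ((((hexp.const_mul δ).mul_const (1 + ‖q.1‖ ^ 2)).const_sub (-M)).sub
      ((hasDerivAt_id q.2).div_const 2)).congr_deriv ?_
    ring
  space := by
    rw [hasGradientAt_iff_hasFDerivAt]
    refine ((((hasStrictFDerivAt_norm_sq q.1).hasFDerivAt.const_add 1).const_mul
      (δ * Real.exp (κ * q.2))).const_sub (-M) |>.sub_const (q.2 / 2)).congr_fderiv ?_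
    ext v
    simp [mul_left_comm, mul_assoc]

theorem quadraticBarrier_add_nonpos {b : E × ℝ → E} {B M δ : ℝ} {q : E × ℝ} (hb : ‖b q‖ ≤ B)
    (hδ : 0 ≤ δ) (hq : 2 * (δ * Real.exp ((B + 1) * q.2)) ≤ 1) :
    ∃ a p, HasPartialsAt (quadraticBarrier M δ (B + 1)) a p q ∧
      a + eikonalHamiltonian b q p ≤ 0 := by
  refine ⟨_, _, hasPartialsAt_quadraticBarrier M δ (B + 1) q, ?_⟩
  set A := δ * Real.exp ((B + 1) * q.2)
  have hA : 0 ≤ A := by positivity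
  have hB : 0 ≤ B := (norm_nonneg _).trans hb
  have hdrift : -(2 * A) * inner ℝ (b q) q.1 ≤ A * (B * (1 + ‖q.1‖ ^ 2)) := by
    have hinner : -inner ℝ (b q) q.1 ≤ B * ‖q.1‖ :=
      (neg_le_abs _).trans ((abs_real_inner_le_norm _ _).trans (by gcongr))
    have hsq : 2 * (B * ‖q.1‖) ≤ B * (1 + ‖q.1‖ ^ 2) := by
      nlinarith [mul_nonneg hB (sq_nonneg (‖q.1‖ - 1))]
    calc -(2 * A) * inner ℝ (b q) q.1 = A * (2 * -inner ℝ (b q) q.1) := by ring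
      _ ≤ A * (B * (1 + ‖q.1‖ ^ 2)) := by exact mul_le_mul_of_nonneg_left (by linarith) hA
  have hquad : (2 * A) ^ 2 * ‖q.1‖ ^ 2 / 2 ≤ A * ‖q.1‖ ^ 2 := by
    nlinarith [mul_nonneg hA (sq_nonneg ‖q.1‖)]
  simp only [driftHamiltonian, inner_smul_right, norm_smul, norm_neg, Real.norm_eq_abs, mul_pow,
    sq_abs] at hquad ⊢
  linarith

end Subquadratic

section EikonalComparison

variable {E : Type*} [NormedAddCommGroup E] [InnerProductSpace ℝ E] [ProperSpace E]
  {b : E × ℝ → E} {B : ℝ} {L : NNReal} {φ v : E × ℝ → ℝ} {φ₀ : E → ℝ}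

theorem IsViscositySubsolutionOn.le_initial_add (hb : ∀ q ∈ openHalf E, ‖b q‖ ≤ B)
    (hbL : LipschitzOnWith L b (openHalf E))
    (hφ : IsViscositySubsolutionOn (openHalf E) (eikonalHamiltonian b) φ)
    (hφc : ContinuousOn φ (openHalf E)) (hφ₀ : InitiallyLE φ fun q => φ₀ q.1) (x : E) {t : ℝ}
    (ht : 0 < t) : φ (x, t) ≤ φ₀ x + B ^ 2 / 2 * t := by
  refine le_of_forall_pos_le_add fun η hη => ?_
  obtain ⟨s, hs, hsφ⟩ := hφ₀.exists_mem_Ioo isCompact_singleton hη ht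
  have hline := hφ.le_along_line hb hbL hφc hs.1 hs.2.le x 0
  rw [smul_zero, add_zero, norm_zero, add_zero] at hline
  have hlate : B ^ 2 / 2 * (t - s) ≤ B ^ 2 / 2 * t := by
    gcongr
    linarith [hs.1]
  linarith [hsφ x rfl]

theorem exists_convexComb_quadraticBarrier_le (hb : ∀ q ∈ openHalf E, ‖b q‖ ≤ B)
    (hbL : LipschitzOnWith L b (openHalf E))
    (hφ : IsViscositySubsolutionOn (openHalf E) (eikonalHamiltonian b) φ)
    (hφc : ContinuousOn φ (openHalf E))
    (hv : IsViscositySubsolutionOn (openHalf E) (eikonalHamiltonian b) v)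
    (hvc : ContinuousOn v (openHalf E)) (hφφ₀ : InitiallyLE φ fun q => φ₀ q.1)
    (hφ₀ : IsSubquadratic φ₀) {l δ : ℝ} (hl : l ∈ Ioo 0 1) (hδ : 0 < δ) (M T : ℝ) :
    ∃ R, ∀ x, R ≤ ‖x‖ → ∀ s ∈ Ioo 0 T,
      (1 - l) * φ (x, s) + l * quadraticBarrier M δ (B + 1) (x, s) ≤ v (x, s) := by
  have hlδ : 0 < l * δ := mul_pos hl.1 hδ
  have hl1 : 0 ≤ 1 - l := sub_nonneg.2 hl.2.le
  have hB : 0 ≤ B := (norm_nonneg _).trans (hb (0, 1) (by simp))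
  obtain ⟨M₀, hM₀⟩ := hφ₀ (l * δ / 4) (by positivity)
  obtain ⟨M₁, hM₁⟩ := hv.exists_neg_sub_normSq_le hb hbL hvc (δ := l * δ / 4) (by positivity) T
  set C := |M₀| + B ^ 2 / 2 * T + l * |M| + M₁ with hC
  refine ⟨max 1 (2 * C / (l * δ)), fun x hx s hs => ?_⟩
  have hxC : 2 * C ≤ l * δ * ‖x‖ ^ 2 := by
    rw [← div_le_iff₀' hlδ]
    exact (le_of_max_le_right hx).trans (le_self_pow₀ (le_of_max_le_left hx) two_ne_zero)
  have hupper : φ (x, s) ≤ |M₀| + l * δ / 4 * ‖x‖ ^ 2 + B ^ 2 / 2 * T := by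
    have hs2 : B ^ 2 / 2 * s ≤ B ^ 2 / 2 * T := by
      gcongr
      exact hs.2.le
    linarith [hφ.le_initial_add hb hbL hφc hφφ₀ x hs.1, le_abs_self (φ₀ x), hM₀ x, le_abs_self M₀]
  have hcomb : (1 - l) * φ (x, s) ≤ |M₀| + l * δ / 4 * ‖x‖ ^ 2 + B ^ 2 / 2 * T :=
    (mul_le_mul_of_nonneg_left hupper hl1).trans
      (mul_le_of_le_one_left (by have := hs.1.trans hs.2; positivity) (by linarith [hl.1]))
  have hbarrier : l * quadraticBarrier M δ (B + 1) (x, s) ≤ l * |M| - l * δ * ‖x‖ ^ 2 := by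
    rw [mul_assoc, ← mul_sub]
    refine mul_le_mul_of_nonneg_left
      ((quadraticBarrier_le hδ.le (by positivity) x hs.1.le).trans ?_) hl.1.le
    linarith [neg_abs_le M]
  linarith [hM₁ x s ⟨hs.1, hs.2.le⟩]

/-- The Hamiltonian is convex, so sub-solutions may be mixed with a classical one that tends to
`-∞` faster than super-solutions do; this reduces comparison to a compact set. -/
theorem eikonal_comparison (hb : ∀ q ∈ openHalf E, ‖b q‖ ≤ B)
    (hbL : LipschitzOnWith L b (openHalf E))
    (hφ : IsViscositySubsolutionOn (openHalf E) (eikonalHamiltonian b) φ)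
    (hφc : ContinuousOn φ (openHalf E))
    (hvsub : IsViscositySubsolutionOn (openHalf E) (eikonalHamiltonian b) v)
    (hvsup : IsViscositySupersolutionOn (openHalf E) (eikonalHamiltonian b) v)
    (hvc : ContinuousOn v (openHalf E)) (hφφ₀ : InitiallyLE φ fun q => φ₀ q.1)
    (hφ₀v : InitiallyLE (fun q => φ₀ q.1) v) (hφ₀ : IsSubquadratic φ₀) (z : E) {t : ℝ}
    (ht : 0 < t) : φ (z, t) ≤ v (z, t) := by
  set δ := Real.exp (-((B + 1) * (t + 1))) / 2 with hδdef
  have hδ : 0 < δ := by positivity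
  have hB : 0 ≤ B := (norm_nonneg _).trans (hb (0, 1) (by simp))
  obtain ⟨M, hM⟩ := hφ₀ δ hδ
  set ψ : E × ℝ → ℝ := quadraticBarrier M δ (B + 1)
  have hψ₀ : ∀ x s, 0 ≤ s → ψ (x, s) ≤ φ₀ x := fun x s hs =>
    (quadraticBarrier_le hδ.le (by positivity) x hs).trans
      (by linarith [neg_abs_le (φ₀ x), hM x])
  have hslab : univ ×ˢ Ioo 0 (t + 1) ⊆ openHalf E := prod_mono_right Ioo_subset_Ioi_self
  have hψ : ∀ q ∈ univ ×ˢ Ioo 0 (t + 1), ∃ a p, HasPartialsAt ψ a p q ∧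
      a + eikonalHamiltonian b q p ≤ 0 := fun q hq => by
    refine quadraticBarrier_add_nonpos (hb q (hslab hq)) hδ.le ?_
    calc 2 * (δ * Real.exp ((B + 1) * q.2))
        = Real.exp (-((B + 1) * (t + 1)) + (B + 1) * q.2) := by
          rw [hδdef, Real.exp_add]
          ring
      _ ≤ 1 := Real.exp_le_one_iff.2 (by nlinarith [hq.2.2])
  have hcomb : ∀ l ∈ Ioo (0 : ℝ) 1, (1 - l) * φ (z, t) + l * ψ (z, t) ≤ v (z, t) := by
    intro l hl
    obtain ⟨R, hR⟩ := exists_convexComb_quadraticBarrier_le hb hbL hφ hφc hvsub hvc hφφ₀ hφ₀ hl hδ M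
      (t + 1)
    exact ((hφφ₀.convexComb hψ₀ hl.1.le hl.2.le).trans hφ₀v).le_of_le_at_infinity
      (fun p => (lipschitzOnWith_driftHamiltonian hbL _ p).mono hslab)
      ((continuousOn_const.mul (hφc.mono hslab)).add
        (continuousOn_const.mul (contDiff_quadraticBarrier _ _ _).continuous.continuousOn))
      (hvc.mono hslab)
      ((hφ.mono hslab fun _ _ _ => le_rfl).convexComb (contDiff_quadraticBarrier _ _ _)
        (fun q _ => convexOn_eikonalHamiltonian q) hψ hl.1.le hl.2)
      (hvsup.mono hslab) hR z ⟨ht, lt_add_one t⟩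
  have hlim : Tendsto (fun l : ℝ => (1 - l) * φ (z, t) + l * ψ (z, t)) (𝓝[>] 0) (𝓝 (φ (z, t))) := by
    have : Continuous fun l : ℝ => (1 - l) * φ (z, t) + l * ψ (z, t) := by fun_prop
    simpa using (this.tendsto 0).mono_left nhdsWithin_le_nhds
  exact le_of_tendsto hlim (mem_of_superset (Ioo_mem_nhdsGT one_pos) hcomb)

end EikonalComparison

/-! ### Comparison for the G-equation -/

section GeometricComparison

variable {E : Type*} [NormedAddCommGroup E] [InnerProductSpace ℝ E]
  {b : E × ℝ → E} {B : ℝ}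

theorem geometricHamiltonian_sub_le {q : E × ℝ} (hb : ‖b q‖ ≤ B) (p r : E) :
    geometricHamiltonian b q (p - r) ≤ geometricHamiltonian b q p + (B + 1) * ‖r‖ := by
  have hdrift : -inner ℝ (b q) r ≤ B * ‖r‖ :=
    (neg_le_abs _).trans ((abs_real_inner_le_norm _ _).trans (by gcongr))
  simp only [driftHamiltonian, inner_sub_right]
  linarith [norm_sub_le p r]

theorem IsViscositySupersolutionOn.mul_exp [CompleteSpace E] {D : Set (E × ℝ)} {G : E × ℝ → ℝ}
    (hG : IsViscositySupersolutionOn D (geometricHamiltonian b) G) {η k : ℝ} (hη : 0 < η)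
    (hk : 0 < k) (c : ℝ) :
    IsViscositySupersolutionOn D (geometricHamiltonian b) fun q => η * Real.exp (k * G q + c) := by
  have hΦ : ∀ y, HasDerivAt (fun y => η * Real.exp (k * y + c))
      (η * (Real.exp (k * y + c) * k)) y :=
    fun y => by simpa using (((hasDerivAt_id y).const_mul k).add_const c).exp.const_mul η
  exact hG.comp (fun q _ r hr p => geometricHamiltonian_smul q hr p)
    (Φ := fun y => η * Real.exp (k * y + c)) (by fun_prop) fun y => (hΦ y).deriv ▸ by positivity

variable [ProperSpace E] {L : NNReal} {v G : E × ℝ → ℝ}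

theorem geometric_comparison_of_closedBall (hb : ∀ q ∈ openHalf E, ‖b q‖ ≤ B)
    (hbL : LipschitzOnWith L b (openHalf E))
    (hv : IsViscositySubsolutionOn (openHalf E) (geometricHamiltonian b) v)
    (hvc : ContinuousOn v (openHalf E))
    (hG : IsViscositySupersolutionOn (openHalf E) (geometricHamiltonian b) G)
    (hGc : ContinuousOn G (openHalf E)) {z : E} {σ t R c : ℝ} (hσ : 0 < σ) (hσt : σ ≤ t)
    (hR : 0 < R) (hRt : 2 * (B + 1) * (t - σ) < R)
    (hle : ∀ x ∈ Metric.closedBall z R, v (x, σ) ≤ G (x, σ) + c) : v (z, t) ≤ G (z, t) + c := by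
  have hB : 0 ≤ B := (norm_nonneg _).trans (hb (0, 1) (by simp))
  have hK : IsCompact (tube (fun _ => z) R σ (t + 1)) := isCompact_tube continuous_const
  have hKH := tube_subset_openHalf (γ := fun _ => z) (R := R) (T := t + 1) hσ
  have hint := interior_subset.trans hKH
  refine le_add_of_frontier_of_penalty
    (f := fun q => ‖q.1 - z‖ ^ 2 + 2 * R * (B + 1) * (q.2 - t)) hK
    (fun p => (lipschitzOnWith_driftHamiltonian hbL _ p).mono hint) (hvc.mono hKH) (hGc.mono hKH)
    (hv.mono hint fun _ _ _ => le_rfl) (hG.mono hint) ?_ (fun q hq => ?_) ?_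
    (q := (z, t)) ⟨by simpa using hR.le, hσt, by simp⟩ (by simp)
  · exact ((contDiff_fst.sub contDiff_const).norm_sq ℝ).add (by fun_prop)
  · refine ⟨_, _, (HasPartialsAt.normSq_sub (hasDerivAt_const q.2 z)).add
      (.of_time (((hasDerivAt_id q.2).sub_const t).const_mul _)), fun p β hβ => ?_⟩
    have hqR : ‖q.1 - z‖ ≤ R := (interior_subset hq).1
    refine (geometricHamiltonian_sub_le (hb q (hint hq)) _ _).trans (add_le_add_right ?_ _)
    rw [inner_zero_right, add_zero, norm_smul, norm_smul, Real.norm_of_nonneg hβ,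
      Real.norm_of_nonneg zero_le_two]
    have : (B + 1) * (β * 2) * ‖q.1 - z‖ ≤ (B + 1) * (β * 2) * R := by gcongr
    linarith
  · rintro q hq hqf
    have hqK := hK.isClosed.frontier_subset hq
    rcases eq_of_mem_frontier_tube continuous_const hq with h | h | h
    · refine absurd hqf (not_le.2 ?_)
      have hspeed : 2 * (B + 1) * (t - q.2) < R :=
        (mul_le_mul_of_nonneg_left (by linarith [hqK.2.1]) (by positivity)).trans_lt hRt
      rw [h]
      nlinarith
    · obtain ⟨x, s⟩ := q
      obtain rfl : s = σ := h
      exact hle x (mem_closedBall_iff_norm.2 hqK.1)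
    · refine absurd hqf (not_le.2 ?_)
      rw [h, add_sub_cancel_left]
      positivity

/-- The equation is invariant under increasing relabelling of level sets, so `G` may be replaced by
`η * exp (k * G + 1)`, which lies above `h` near time `0` for `k` large. -/
theorem nonpos_of_geometric_nonpos (hb : ∀ q ∈ openHalf E, ‖b q‖ ≤ B)
    (hbL : LipschitzOnWith L b (openHalf E))
    (hv : IsViscositySubsolutionOn (openHalf E) (geometricHamiltonian b) v)
    (hvc : ContinuousOn v (openHalf E))
    (hG : IsViscositySupersolutionOn (openHalf E) (geometricHamiltonian b) G)
    (hGc : ContinuousOn G (openHalf E)) {g h : E → ℝ} (hg : Continuous g) (hh : Continuous h)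
    (hgh : ∀ x, g x ≤ 0 → h x ≤ 0) (hvh : InitiallyLE v fun q => h q.1)
    (hgG : InitiallyLE (fun q => g q.1) G) {z : E} {t : ℝ} (ht : 0 < t) (hz : G (z, t) ≤ 0) :
    v (z, t) ≤ 0 := by
  have hB : 0 ≤ B := (norm_nonneg _).trans (hb (0, 1) (by simp))
  have hη : ∀ η > 0, v (z, t) ≤ η * Real.exp 1 + η := fun η hη => by
    set R := 2 * (B + 1) * t + 1
    have hK := isCompact_closedBall z R
    obtain ⟨k, hk, hkgh⟩ := exists_le_mul_exp hK hg.continuousOn hh.continuousOn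
      (fun x _ => hgh x) hη
    obtain ⟨σ, hσ, hσv, hσG⟩ := ((eventually_mem_set.2 (Ioo_mem_nhdsGT ht)).and
      ((hvh _ hK η hη).and (hgG _ hK k⁻¹ (inv_pos.2 hk)))).exists
    have hstart : ∀ x ∈ Metric.closedBall z R,
        v (x, σ) ≤ η * Real.exp (k * G (x, σ) + 1) + η := fun x hx => by
      have hkG : k * g x ≤ k * G (x, σ) + 1 := by
        simpa [mul_add, hk.ne'] using mul_le_mul_of_nonneg_left (hσG x hx) hk.le
      calc v (x, σ) ≤ h x + η := hσv x hx
        _ ≤ η * Real.exp (k * g x) + η := by gcongr; exact hkgh x hx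
        _ ≤ η * Real.exp (k * G (x, σ) + 1) + η := by gcongr
    calc v (z, t) ≤ η * Real.exp (k * G (z, t) + 1) + η :=
          geometric_comparison_of_closedBall hb hbL hv hvc (hG.mul_exp hη hk 1) (by fun_prop) hσ.1
            hσ.2.le (by positivity) (by nlinarith [hσ.1]) hstart
      _ ≤ η * Real.exp 1 + η := by
        gcongr
        linarith [mul_nonpos_of_nonneg_of_nonpos hk.le hz]
  have hlim : Tendsto (fun η : ℝ => η * Real.exp 1 + η) (𝓝[>] 0) (𝓝 0) :=
    (Continuous.tendsto' (by fun_prop) 0 0 (by simp)).mono_left nhdsWithin_le_nhds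
  exact ge_of_tendsto hlim (eventually_mem_nhdsWithin.mono hη)

end GeometricComparison

/-! ### Level sets of front-like solutions -/

section Solutions

variable {m : ℕ} {H : Space m → ℝ → Space m → ℝ} {v₀ g : Space m → ℝ} {v : Space m → ℝ → ℝ}

theorem IsSubsolution.isViscositySubsolutionOn (h : IsSubsolution H v) :
    IsViscositySubsolutionOn (openHalf (Space m)) (fun q => H q.1 q.2) (Function.uncurry v) :=
  fun ψ hψ q hq a p hp hmax => by
    simpa only [hp.time.deriv, hp.space.gradient] using h ψ hψ q.1 q.2 hq.2 hmax

theorem IsSupersolution.isViscositySupersolutionOn (h : IsSupersolution H v) :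
    IsViscositySupersolutionOn (openHalf (Space m)) (fun q => H q.1 q.2) (Function.uncurry v) :=
  fun ψ hψ q hq a p hp hmin => by
    simpa only [hp.time.deriv, hp.space.gradient] using h ψ hψ q.1 q.2 hq.2 hmin

theorem initiallyLE_of_eventually {E : Type*} [NormedAddCommGroup E] {f g : E × ℝ → ℝ}
    (h : ∀ z, ∀ η > 0, ∀ᶠ q in 𝓝[closedHalf E] (z, 0), f q ≤ g q + η) : InitiallyLE f g := by
  intro C hC η hη
  have hnear : ∀ᶠ s in 𝓝 (0 : ℝ), ∀ z ∈ C, 0 ≤ s → f (z, s) ≤ g (z, s) + η := by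
    refine hC.eventually_forall_of_forall_eventually fun z _ => ?_
    filter_upwards [(continuous_swap.tendsto (0, z)).eventually
      (eventually_nhdsWithin_iff.1 (h z η hη))] with q hq hs
    exact hq ⟨mem_univ _, hs⟩
  filter_upwards [nhdsWithin_le_nhds hnear, self_mem_nhdsWithin] with s hs hs0 x hx
  exact hs x hx (le_of_lt hs0)

theorem IsSolution.initiallyLE (hv : IsSolution H v₀ v) (hg : Continuous g)
    (hvg : ∀ z, v₀ z ≤ g z) : InitiallyLE (Function.uncurry v) fun q => g q.1 := by
  refine initiallyLE_of_eventually fun z η hη => ?_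
  have hlimsup : limsup (fun z' => (v₀ z' : EReal)) (𝓝 z) ≤ g z :=
    (limsup_le_limsup (.of_forall fun z' => EReal.coe_le_coe_iff.2 (hvg z'))).trans_eq
      ((continuous_coe_real_ereal.comp hg).tendsto z).limsup_eq
  have hlt : limsup (fun q : Space m × ℝ => (v q.1 q.2 : EReal)) (𝓝[closedHalf (Space m)] (z, 0)) <
      (g z + η / 2 : ℝ) :=
    ((hv.initial_upper z).trans hlimsup).trans_lt (EReal.coe_lt_coe_iff.2 (by linarith))
  have hgz : ∀ᶠ q in 𝓝[closedHalf (Space m)] (z, (0 : ℝ)), g z - η / 2 < g q.1 :=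
    nhdsWithin_le_nhds (((hg.comp continuous_fst).tendsto (z, (0 : ℝ))).eventually_const_lt
      (sub_lt_self _ (half_pos hη)))
  filter_upwards [eventually_lt_of_limsup_lt hlt, hgz] with q hq hgq
  have := EReal.coe_lt_coe_iff.1 hq
  simp only [Function.uncurry]
  linarith

theorem IsSolution.le_initially (hv : IsSolution H v₀ v) (hg : Continuous g)
    (hgv : ∀ z, g z ≤ v₀ z) : InitiallyLE (fun q => g q.1) (Function.uncurry v) := by
  refine initiallyLE_of_eventually fun z η hη => ?_
  have hliminf : (g z : EReal) ≤ liminf (fun z' => (v₀ z' : EReal)) (𝓝 z) :=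
    ((continuous_coe_real_ereal.comp hg).tendsto z).liminf_eq.symm.trans_le
      (liminf_le_liminf (.of_forall fun z' => EReal.coe_le_coe_iff.2 (hgv z')))
  have hlt : (g z - η / 2 : ℝ) <
      liminf (fun q : Space m × ℝ => (v q.1 q.2 : EReal)) (𝓝[closedHalf (Space m)] (z, 0)) :=
    (EReal.coe_lt_coe_iff.2 (by linarith)).trans_le (hliminf.trans (hv.initial_lower z))
  have hgz : ∀ᶠ q in 𝓝[closedHalf (Space m)] (z, (0 : ℝ)), g q.1 < g z + η / 2 :=
    nhdsWithin_le_nhds (((hg.comp continuous_fst).tendsto (z, (0 : ℝ))).eventually_lt_const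
      (lt_add_of_pos_right _ (half_pos hη)))
  filter_upwards [eventually_lt_of_lt_liminf hlt, hgz] with q hq hgq
  have := EReal.coe_lt_coe_iff.1 hq
  simp only [Function.uncurry]
  linarith

end Solutions

section FrontLike

theorem IsProfile.strictMono {g : ℝ → ℝ} (hg : IsProfile g) : StrictMono g := by
  have hc : Continuous g := hg.locallyLipschitz.continuous
  refine StrictMonoOn.Iic_union_Ici (a := 0) ?_ ?_
  · exact strictMonoOn_of_deriv_pos (convex_Iic 0) hc.continuousOn fun y hy =>
      hg.deriv_pos y (interior_Iic.subset hy).ne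
  · exact strictMonoOn_of_deriv_pos (convex_Ici 0) hc.continuousOn fun y hy =>
      hg.deriv_pos y (interior_Ici.subset hy).ne'

theorem FrontLike.exists_continuous_ge {m : ℕ} {G₀ v₀ : Space m → ℝ} (hG₀ : FrontLike G₀)
    (hv₀ : FrontLike v₀) :
    ∃ h : Space m → ℝ, Continuous h ∧ (∀ z, v₀ z ≤ h z) ∧ ∀ z, G₀ z ≤ 0 → h z ≤ 0 := by
  obtain ⟨lo, _, hlo, _, hloG⟩ := hG₀.exists_profiles
  obtain ⟨_, hi, _, hhi, hvhi⟩ := hv₀.exists_profiles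
  refine ⟨fun z => hi (yPart z), ?_, fun z => (hvhi z).2, fun z hz => ?_⟩
  · have hy : Continuous (yPart : Space m → ℝ) := by
      unfold yPart
      fun_prop
    exact hhi.locallyLipschitz.continuous.comp hy
  · have hy : yPart z ≤ 0 :=
      hlo.strictMono.le_iff_le.1 (((hloG z).1.trans hz).trans_eq hlo.map_zero.symm)
    exact (hhi.strictMono.monotone hy).trans_eq hhi.map_zero

end FrontLike

section Advection

variable {m : ℕ}

theorem differentiableOn_advection {uperp : Space m → ℝ → EuclideanSpace ℝ (Fin m)}
    {upar : EuclideanSpace ℝ (Fin m) → ℝ → ℝ} {w : ℝ → ℝ}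
    (hperp : DifferentiableOn ℝ (Function.uncurry uperp) (closedHalf (Space m)))
    (hpar : DifferentiableOn ℝ (Function.uncurry upar) (closedHalf (EuclideanSpace ℝ (Fin m))))
    (hw : Differentiable ℝ w) :
    DifferentiableOn ℝ (Function.uncurry (advection uperp upar w)) (closedHalf (Space m)) := by
  refine differentiableOn_euclidean.2 fun i => i.lastCases ?_ fun j => ?_
  · have hx : Differentiable ℝ fun q : Space m × ℝ => (xPart q.1, q.2) := by
      refine Differentiable.prodMk (differentiable_euclidean.2 fun j => ?_) differentiable_snd
      simp only [xPart]
      fun_prop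
    have hy : Differentiable ℝ fun q : Space m × ℝ => yPart q.1 := by
      unfold yPart
      fun_prop
    exact ((hpar.comp hx.differentiableOn fun q hq => ⟨mem_univ _, hq.2⟩).mul
      (hw.comp hy).differentiableOn).congr fun q _ => by simp [Function.uncurry, advection]
  · exact (differentiableOn_euclidean.1 hperp j).congr fun q _ => by
      simp [Function.uncurry, advection]

theorem HasFiniteC1Norm.exists_bound_lipschitzOnWith {u : Space m → ℝ → Space m}
    (hu : HasFiniteC1Norm u)
    (hd : DifferentiableOn ℝ (Function.uncurry u) (closedHalf (Space m))) :
    ∃ (C : ℝ) (L : NNReal), (∀ z t, 0 ≤ t → ‖u z t‖ ≤ C) ∧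
      LipschitzOnWith L (Function.uncurry u) (closedHalf (Space m)) := by
  obtain ⟨C, hC⟩ := hu
  exact ⟨C, C.toNNReal, fun z t ht => (hC z t ht).1,
    (convex_univ.prod (convex_Ici 0)).lipschitzOnWith_of_nnnorm_fderivWithin_le hd
      fun q hq => NNReal.le_toNNReal_of_coe_le (hC q.1 q.2 hq.2).2⟩

theorem IsAdmissible.ae_exists_bound_lipschitzOnWith {Ω : Type*} [MeasurableSpace Ω] {P : Measure Ω}
    {w : ℝ → Ω → ℝ} {uperp : Space m → ℝ → EuclideanSpace ℝ (Fin m)}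
    {upar : EuclideanSpace ℝ (Fin m) → ℝ → ℝ} (hu : IsAdmissible P w uperp upar) :
    ∀ᵐ ω ∂P, ∃ (C : ℝ) (L : NNReal),
      (∀ z t, 0 ≤ t → ‖advection uperp upar (fun y => w y ω) z t‖ ≤ C) ∧
      LipschitzOnWith L (Function.uncurry (advection uperp upar fun y => w y ω))
        (closedHalf (Space m)) := by
  obtain ⟨M, -, hM⟩ := hu.noise.bounded
  filter_upwards [hu.finiteC1, hM] with ω hω hwω
  exact hω.exists_bound_lipschitzOnWith (differentiableOn_advection
    (hu.perp.differentiableOn two_ne_zero) (hu.par.differentiableOn two_ne_zero)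
    (hwω.1.differentiable one_ne_zero))

/-- The drift `ε u(x, y, ε^α t)` of both equations. -/
noncomputable def scaledDrift (u : Space m → ℝ → Space m) (ε : ℝ) (α : ℝ≥0∞) (q : Space m × ℝ) :
    Space m :=
  ε • u q.1 (epsPow ε α * q.2)

variable {u : Space m → ℝ → Space m} {ε : ℝ}

theorem geometricH_eq_geometricHamiltonian (u : Space m → ℝ → Space m) (ε : ℝ) (α : ℝ≥0∞) :
    (fun q : Space m × ℝ => geometricH u ε α q.1 q.2) =
      geometricHamiltonian (scaledDrift u ε α) := by
  funext q p
  rw [geometricH, geometricHamiltonian, driftHamiltonian, scaledDrift, real_inner_smul_left]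

theorem eikonalH_eq_eikonalHamiltonian (u : Space m → ℝ → Space m) (ε : ℝ) (α : ℝ≥0∞) :
    (fun q : Space m × ℝ => eikonalH u ε α q.1 q.2) = eikonalHamiltonian (scaledDrift u ε α) := by
  funext q p
  rw [eikonalH, eikonalHamiltonian, driftHamiltonian, scaledDrift, real_inner_smul_left, add_assoc]

theorem epsPow_nonneg (hε : 0 ≤ ε) (α : ℝ≥0∞) : 0 ≤ epsPow ε α := by
  unfold epsPow
  positivity

theorem norm_scaledDrift_le {C : ℝ} (hu : ∀ z t, 0 ≤ t → ‖u z t‖ ≤ C) (hε : 0 ≤ ε) (α : ℝ≥0∞)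
    {q : Space m × ℝ} (hq : q ∈ openHalf (Space m)) : ‖scaledDrift u ε α q‖ ≤ ε * C := by
  rw [scaledDrift, norm_smul, Real.norm_of_nonneg hε]
  exact mul_le_mul_of_nonneg_left (hu _ _ (mul_nonneg (epsPow_nonneg hε α) (le_of_lt hq.2))) hε

theorem lipschitzOnWith_scaledDrift {L : NNReal}
    (hu : LipschitzOnWith L (Function.uncurry u) (closedHalf (Space m))) (hε : 0 ≤ ε) (α : ℝ≥0∞) :
    LipschitzOnWith (‖ε‖₊ * (L * max 1 ‖epsPow ε α‖₊)) (scaledDrift u ε α)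
      (openHalf (Space m)) := by
  have hscale : LipschitzWith (max 1 ‖epsPow ε α‖₊)
      fun q : Space m × ℝ => (q.1, epsPow ε α * q.2) := by
    simpa using LipschitzWith.prod_fst.prodMk
      ((lipschitzWith_smul (epsPow ε α)).comp (LipschitzWith.prod_snd (α := Space m) (β := ℝ)))
  have hmaps : MapsTo (fun q : Space m × ℝ => (q.1, epsPow ε α * q.2)) (openHalf (Space m))
      (closedHalf (Space m)) :=
    fun q hq => ⟨mem_univ _, mul_nonneg (epsPow_nonneg hε α) (le_of_lt hq.2)⟩
  have hcomp := hu.comp hscale.lipschitzOnWith hmaps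
  exact (lipschitzWith_smul ε).comp_lipschitzOnWith hcomp

end Advection

theorem proposition2p4_general {m : ℕ} {u : Space m → ℝ → Space m} {C : ℝ} {L : NNReal}
    (huC : ∀ z t, 0 ≤ t → ‖u z t‖ ≤ C)
    (huL : LipschitzOnWith L (Function.uncurry u) (closedHalf (Space m)))
    {ε : ℝ} (hε : 0 ≤ ε) {α : ℝ≥0∞} {G₀ φ₀ v₀ h : Space m → ℝ} {G φ v : Space m → ℝ → ℝ}
    (hG : IsSolution (geometricH u ε α) G₀ G) (hG₀ : Continuous G₀)
    (hφ : IsSolution (eikonalH u ε α) φ₀ φ) (hφ₀ : Continuous φ₀) (hφ₀sq : IsSubquadratic φ₀)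
    (hv : IsSolution (eikonalH u ε α) v₀ v) (hφv : ∀ z, φ₀ z ≤ v₀ z)
    (hh : Continuous h) (hvh : ∀ z, v₀ z ≤ h z) (hGh : ∀ z, G₀ z ≤ 0 → h z ≤ 0)
    {t : ℝ} (ht : 0 ≤ t) :
    {z | G z t ≤ 0} ⊆ {z | v z t ≤ 0} ∧ {z | v z t ≤ 0} ⊆ {z | φ z t ≤ 0} := by
  rcases ht.eq_or_lt with rfl | ht
  · simp only [hG.initial, hφ.initial, hv.initial]
    exact ⟨fun z hz => (hvh z).trans (hGh z hz), fun z hz => (hφv z).trans hz⟩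
  have hb : ∀ q ∈ openHalf (Space m), ‖scaledDrift u ε α q‖ ≤ ε * C :=
    fun q hq => norm_scaledDrift_le huC hε α hq
  have hbL := lipschitzOnWith_scaledDrift huL hε α
  have hGsup := geometricH_eq_geometricHamiltonian u ε α ▸ hG.super.isViscositySupersolutionOn
  have hφsub := eikonalH_eq_eikonalHamiltonian u ε α ▸ hφ.sub.isViscositySubsolutionOn
  have hvsub := eikonalH_eq_eikonalHamiltonian u ε α ▸ hv.sub.isViscositySubsolutionOn
  have hvsup := eikonalH_eq_eikonalHamiltonian u ε α ▸ hv.super.isViscositySupersolutionOn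
  refine ⟨fun z hz => ?_, fun z hz => ?_⟩
  · exact nonpos_of_geometric_nonpos hb hbL
      (hvsub.mono Subset.rfl fun q _ p => geometricHamiltonian_le_eikonalHamiltonian q p)
      hv.continuousOn hGsup hG.continuousOn hG₀ hh hGh (hv.initiallyLE hh hvh)
      (hG.le_initially hG₀ fun _ => le_rfl) ht hz
  · exact (eikonal_comparison hb hbL hφsub hφ.continuousOn hvsub hvsup hv.continuousOn
      (hφ.initiallyLE hφ₀ fun _ => le_rfl) (hv.le_initially hφ₀ hφv) hφ₀sq z ht).trans hz

end FrontProp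

theorem proposition2p4 {Ω : Type*} [MeasurableSpace Ω] (P : Measure Ω) [IsProbabilityMeasure P]
    (m : ℕ) (w : ℝ → Ω → ℝ)
    (uperp : FrontProp.Space m → ℝ → EuclideanSpace ℝ (Fin m))
    (upar : EuclideanSpace ℝ (Fin m) → ℝ → ℝ)
    (hu : FrontProp.IsAdmissible P w uperp upar) :
    ∀ᵐ ω ∂P, ∀ u : FrontProp.Space m → ℝ → FrontProp.Space m,
      u = FrontProp.advection uperp upar (fun y => w y ω) →
      ∀ (ε : ℝ) (α : ℝ≥0∞), 0 < ε → 1 ≤ α →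
      ∀ χG χv : EuclideanSpace ℝ (Fin m) → ℝ → ℝ → ℝ,
      FrontProp.IsPTW (FrontProp.geometricH u ε α) ε χG →
      FrontProp.IsPTW (FrontProp.eikonalH u ε α) ε χv →
      ∀ (v₀ : FrontProp.Space m → ℝ) (v : FrontProp.Space m → ℝ → ℝ),
      FrontProp.FrontLike v₀ →
      (∀ z, FrontProp.ptw ε χv z 0 ≤ v₀ z) →
      FrontProp.IsSolution (FrontProp.eikonalH u ε α) v₀ v →
      ∀ t : ℝ, 0 ≤ t →
        {z | FrontProp.ptw ε χG z t ≤ 0} ⊆ {z | v z t ≤ 0} ∧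
        {z | v z t ≤ 0} ⊆ {z | FrontProp.ptw ε χv z t ≤ 0} := by
  filter_upwards [hu.ae_exists_bound_lipschitzOnWith]
  rintro ω ⟨C, L, huC, huL⟩ _ rfl ε α hε - χG χv ⟨hG, hGf, _, hGK⟩ ⟨hφ, -, _, hφK⟩ v₀ v hvf hφv hv t
    ht
  obtain ⟨h, hh, hvh, hGh⟩ := hGf.exists_continuous_ge hvf
  exact FrontProp.proposition2p4_general huC huL hε.le hG hGK.continuous hφ hφK.continuous
    (FrontProp.isSubquadratic_of_lipschitzWith hφK) hv hφv hh hvh hGh ht
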